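/- **Setting.** A chore instance consists of agents $N=\{1,\dots,n\}$ with weights $w_i>0$, $\sum_{i} w_i=1$, items $M=\{e_1,\dots,e_m\}$, and additive cost functions with $0\le c_i(e)\le 1$. Write $c_i(M)=\sum_{e} c_i(e)$ and $\mathsf{WPROP}_i=w_i\,c_i(M)$; for a fractional bundle $y\in[0,1]^M$ write $c_i(y)=\sum_e y(e)c_i(e)$. Assume that the instance has identical ordering: $c_i(e_1)\le c_i(e_2)\le\dots\le c_i(e_m)$ for all $i$. The *Fractional Bid-and-Take Algorithm* starts with all agents active and processes the items in the order $e_1,\dots,e_m$. As long as a fraction $z>0$ of the current item $e$ remains, take the active agent $i$ with minimum $c_i(e)/c_i(M)$ (lowest index on ties; $0/0=0$). If $c_i(x_i)+z\,c_i(e)>\mathsf{WPROP}_i$, then set $x_i(e)=(\mathsf{WPROP}_i-c_i(x_i))/c_i(e)$, subtract $x_i(e)$ from $z$, and make $i$ inactive; otherwise set $x_i(e)=z$ and go to the next item. Let $x$ be the fractional allocation returned. An item is *fractional* if at least two agents $i$ have $x_i(e)>0$. The *item-sharing graph* $G$ has the agents as nodes and a directed edge $i\to j$, labelled $e$, whenever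 $j$ is the next agent to receive a positive fraction of $e$ after $i$. An *item-tree* is a subtree $T$ of $G$ (a set of edges) that contains, with each edge, all edges of $G$ with the same label. An *atom-path* is a maximal path of at least two edges in $G$ all of which have the same label. A *rounding* of $x$ gives each item $e$ entirely to one agent $i$ with $x_i(e)>0$. **Theorem.** 1. Suppose that $x$ has fewer than $n-1$ fractional items. Then there are a rounding of $x$ to an integral allocation $(X_1,\dots,X_n)$ and subsidies $s_i\ge 0$ such that $c_i(X_i)-s_i\le \mathsf{WPROP}_i$ for all $i$ (the allocation is WPROPS) and $\sum_i s_i\le \frac{n-1}{3}$. If moreover $G$ is a tree, then some item is shared by three or more agents. 2. Let $T$ be an item-tree with $z\ge 2$ edges that contains an atom-path. Then the items labelling the edges of $T$ can be rounded with total subsidy at most $z/3$: there are a rounding of $x$ and subsidies $s_i\ge 0$ with $\sum_i s_i\le \frac z3$ such that, if $x^T$ denotes the allocation in which the items of $T$ are rounded and all other items are left as in $x$, then $c_i(x^T_i)-s_i\le c_i(x_i)$ and $c_i(x^T_i)-s_i\le \mathsf{WPROP}_i$ for every agent $i$. -/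

import Mathlib

noncomputable section

/-- A chore instance: agents `Fin n` with positive weights summing to one, items `Fin m`, and
additive costs given by the cost `c i e ∈ [0, 1]` of each item `e` to each agent `i`. -/
structure ChoreInstance (n m : ℕ) where
  w : Fin n → ℝ
  c : Fin n → Fin m → ℝ
  w_pos : ∀ i, 0 < w i
  w_sum : ∑ i, w i = 1
  c_nonneg : ∀ i e, 0 ≤ c i e
  c_le_one : ∀ i e, c i e ≤ 1

/-- The state of the Fractional Bid-and-Take Algorithm. Items are processed in the order
`0, 1, …, m - 1`. -/
structure FBTAState (n m : ℕ) where
  /-- `x i e` is the fraction of item `e` given to agent `i` so far -/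
  x : Fin n → Fin m → ℝ
  /-- the set of active agents -/
  active : Finset (Fin n)
  /-- `z e` is the remaining fraction of item `e` -/
  z : Fin m → ℝ
  /-- the index of the item to be allocated -/
  j : ℕ
  /-- chronological record of all events "agent `i` receives a positive fraction of item `e`" -/
  takes : List (Fin n × Fin m)

/-- A directed edge `tail → head`, labelled with the item that it stands for. -/
structure SharingEdge (n m : ℕ) where
  tail : Fin n
  item : Fin m
  head : Fin n

/-- The undirected graph on the agents that is spanned by a set of edges. -/
def SharingEdge.graph {n m : ℕ} (T : Set (SharingEdge n m)) : SimpleGraph (Fin n) :=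
  SimpleGraph.fromRel fun i j => ∃ e, (⟨i, e, j⟩ : SharingEdge n m) ∈ T

/-- The agents that are endpoints of an edge of `T`. -/
def SharingEdge.nodes {n m : ℕ} (T : Set (SharingEdge n m)) : Set (Fin n) :=
  {i | ∃ a ∈ T, a.tail = i ∨ a.head = i}

namespace ChoreInstance

variable {n m : ℕ} (I : ChoreInstance n m)

/-- Identical ordering: `c i e₁ ≤ c i e₂ ≤ ⋯ ≤ c i eₘ` for every agent `i`. -/
def IsIDO : Prop := ∀ i, Monotone (I.c i)

/-- The cost of the whole set of items to agent `i`. -/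
def total (i : Fin n) : ℝ := ∑ e, I.c i e

/-- The proportional share of agent `i`. -/
def share (i : Fin n) : ℝ := I.w i * I.total i

/-- The cost of a fractional bundle `y` to agent `i`. -/
def cost (i : Fin n) (y : Fin m → ℝ) : ℝ := ∑ e, y e * I.c i e

open scoped Classical in
/-- The active agents `i` that minimise `c i e / c i M`. -/
def bidders (A : Finset (Fin n)) (e : Fin m) : Finset (Fin n) :=
  {i ∈ A | ∀ k ∈ A, I.c i e / I.total i ≤ I.c k e / I.total k}

/-- The start of the algorithm: nothing is allocated and all agents are active. -/
def initState (n m : ℕ) : FBTAState n m where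
  x := fun _ _ => 0
  active := Finset.univ
  z := fun _ => 1
  j := 0
  takes := []

open scoped Classical in
/-- One iteration of the while loop: the lowest-numbered bidder `i` takes the current item `e`
until either her share is reached, and she becomes inactive, or `e` is used up. -/
def step (S : FBTAState n m) : FBTAState n m :=
  if hj : S.j < m then
    let e : Fin m := ⟨S.j, hj⟩
    if hA : (I.bidders S.active e).Nonempty then
      let i : Fin n := (I.bidders S.active e).min' hA
      if I.share i < I.cost i (S.x i) + S.z e * I.c i e then
        let a : ℝ := (I.share i - I.cost i (S.x i)) / I.c i e
        { x := Function.update S.x i (Function.update (S.x i) e a)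
          active := S.active.erase i
          z := Function.update S.z e (S.z e - a)
          j := S.j
          takes := if 0 < a then S.takes ++ [(i, e)] else S.takes }
      else
        { x := Function.update S.x i (Function.update (S.x i) e (S.z e))
          active := S.active
          z := Function.update S.z e 0
          j := S.j + 1
          takes := if 0 < S.z e then S.takes ++ [(i, e)] else S.takes }
    else S
  else S

/-- The final state. Every iteration removes an active agent or passes to the next item, so
after `n + m` iterations the loop has ended (and `step` does nothing any more). -/
def final : FBTAState n m := I.step^[n + m] (initState n m)

/-- The fractional allocation returned by the Fractional Bid-and-Take Algorithm. -/
def x : Fin n → Fin m → ℝ := I.final.x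

open scoped Classical in
/-- The agents who hold a positive fraction of item `e`. -/
def holders (e : Fin m) : Finset (Fin n) := {i | 0 < I.x i e}

open scoped Classical in
/-- The items shared by at least two agents. -/
def fractionalItems : Finset (Fin m) := {e | 2 ≤ (I.holders e).card}

/-- The directed edges `i → j` of the item-sharing graph: agent `i` becomes inactive before item
`e` is used up, and `j` is the next agent who takes from `e`; that is, `j` takes from `e`
directly after `i` has taken from `e`. -/
def edges : Set (SharingEdge n m) :=
  {a | [(a.tail, a.item), (a.head, a.item)] <:+: I.final.takes}

/-- `T` is a tree formed by edges of the item-sharing graph that contains, with an edge, all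
edges that stand for the same item. -/
structure IsItemTree (T : Finset (SharingEdge n m)) : Prop where
  subset : ∀ a ∈ T, a ∈ I.edges
  isTree : ((SharingEdge.graph (T : Set (SharingEdge n m))).induce
    (SharingEdge.nodes (T : Set (SharingEdge n m)))).IsTree
  closed : ∀ a ∈ T, ∀ b ∈ I.edges, b.item = a.item → b ∈ T

/-- The list `v` of agents is a directed path in the item-sharing graph all of whose edges stand
for item `e`. -/
def IsPathOf (e : Fin m) (v : List (Fin n)) : Prop :=
  v.Nodup ∧ v.IsChain fun i j => (⟨i, e, j⟩ : SharingEdge n m) ∈ I.edges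

/-- An atom-path: a maximal path, of at least two edges, all of whose edges stand for the same
item `e`. -/
def IsAtomPath (e : Fin m) (v : List (Fin n)) : Prop :=
  3 ≤ v.length ∧ I.IsPathOf e v ∧ ∀ v', I.IsPathOf e v' → v <:+: v' → v' = v

/-- The edge set `T` contains all edges of some atom-path. -/
def ContainsAtomPath (T : Finset (SharingEdge n m)) : Prop :=
  ∃ e v, I.IsAtomPath e v ∧ v.IsChain fun i j => (⟨i, e, j⟩ : SharingEdge n m) ∈ T

/-- An integral allocation, given as the map `X` from items to their owners, is a rounding of the
fractional allocation: each item goes to an agent who holds a positive fraction of it. -/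
def IsRounding (X : Fin m → Fin n) : Prop := ∀ e, 0 < I.x (X e) e

open scoped Classical in
/-- Weighted proportionality with subsidies `s` of the integral allocation `X`. -/
def IsWPROPS (X : Fin m → Fin n) (s : Fin n → ℝ) : Prop :=
  ∀ i, 0 ≤ s i ∧ (∑ e with X e = i, I.c i e) - s i ≤ I.share i

open scoped Classical in
/-- The allocation obtained from the fractional one by giving each item of `T` entirely to its
owner under `X` and changing nothing else. -/
def roundOn (T : Finset (SharingEdge n m)) (X : Fin m → Fin n) (i : Fin n) (e : Fin m) : ℝ :=
  if ∃ a ∈ T, a.item = e then (if X e = i then 1 else 0) else I.x i e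

end ChoreInstance

end

/-! Since `x` respects every share, it suffices to round so that the sum over agents of the positive
parts of the cost increases is small; these positive parts are the subsidies. An item with k holders
gets a budget of (k-1)/3, that is, 1/3 per edge of the sharing graph.

Three local estimates carry the argument. Two items with two holders each and a common holder can be
rounded at cost 2/3 (`roundsWithin_pair`). An item with at least three holders can be rounded within
budget together with two-holder items ("satellites") attached to distinct holders of it
(`roundsWithin_bigStar`): the central item is given away at random with the probabilities `x`, each
satellite responds optimally, and some outcome is no worse than the average. A two-holder item
rounded alone costs at most 1/2, which is 1/6 over budget (`roundsWithin_singleton`).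

Assign every two-holder item to one of its holders and pair up the items assigned to the same agent;
one item is left at each agent of odd parity. It becomes a satellite if the agent also holds a
larger item; otherwise it is rounded alone. Let `B` be the set of agents of the latter kind. Moving
items along paths of two-holder items changes the parities of the end points only, so with `B` as
small as possible each component of the two-holder items that meets `B` contains a single agent of
`B` and touches no larger item. The total is at most the budget plus |B|/6 (`exists_roundsWithin`).

In the graph of the algorithm each agent is the tail of edges of at most one item, so the budget is
at most (n-r)/3, where r counts the agents without outgoing edge (roots). Each component that meets
`B` contains a root, so |B| ≤ r, and (n-r)/3 + r/6 ≤ (n-1)/3 once r ≥ 2. If r = 1, the graph is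
connected and a count of edges yields an item with three holders, whence `B` is empty. An atom-path
makes `B` empty in the same way for an item-tree. -/

noncomputable section

/-! ### The run of the algorithm: numerical invariants and termination. -/

namespace ChoreInstance

variable {n m : ℕ} (I : ChoreInstance n m)

/-- `S'` arises from `S` when agent `i` takes the fraction `a` of the current item `e`. -/
structure IsTake (S S' : FBTAState n m) (i : Fin n) (e : Fin m) (a : ℝ) : Prop where
  item_eq : (e : ℕ) = S.j
  mem : i ∈ S.active
  le_ratio : ∀ k ∈ S.active, I.c i e / I.total i ≤ I.c k e / I.total k
  nonneg : 0 ≤ a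
  x_eq : S'.x = Function.update S.x i (Function.update (S.x i) e a)
  z_eq : S'.z = Function.update S.z e (S.z e - a)
  takes_eq : S'.takes = if 0 < a then S.takes ++ [(i, e)] else S.takes
  cases : (a = S.z e ∧ S'.active = S.active ∧ S'.j = S.j + 1 ∧
      I.cost i (S.x i) + a * I.c i e ≤ I.share i) ∨
    (a < S.z e ∧ S'.active = S.active.erase i ∧ S'.j = S.j ∧ 0 < I.c i e ∧
      I.cost i (S.x i) + a * I.c i e = I.share i)

/-- The numerical invariants of the algorithm. -/
structure Valid (S : FBTAState n m) : Prop where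
  j_le : S.j ≤ m
  active_nonempty : S.active.Nonempty
  x_nonneg : ∀ i e, 0 ≤ S.x i e
  x_later : ∀ i (e : Fin m), S.j < e → S.x i e = 0
  x_active : ∀ i ∈ S.active, ∀ e : Fin m, S.j ≤ e → S.x i e = 0
  z_eq : ∀ e, S.z e = 1 - ∑ i, S.x i e
  z_done : ∀ e : Fin m, e < S.j → S.z e = 0
  z_pos : ∀ e : Fin m, S.j ≤ e → 0 < S.z e
  cost_le : ∀ i, I.cost i (S.x i) ≤ I.share i
  cost_inactive : ∀ i ∉ S.active, I.cost i (S.x i) = I.share i ∧ 0 < I.total i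
  le_ratio : ∀ k ∈ S.active, ∀ i e, 0 < S.x i e → I.c i e / I.total i ≤ I.c k e / I.total k
  mem_takes : ∀ i e, (i, e) ∈ S.takes ↔ 0 < S.x i e

lemma bidders_nonempty {A : Finset (Fin n)} (hA : A.Nonempty) (e : Fin m) :
    (I.bidders A e).Nonempty := by
  obtain ⟨i, hi, h⟩ := A.exists_min_image (fun i => I.c i e / I.total i) hA
  exact ⟨i, by simpa [bidders] using ⟨hi, h⟩⟩

lemma isTake_step {S : FBTAState n m} (hS : I.Valid S) (hj : S.j < m) :
    ∃ i e a, I.IsTake S (I.step S) i e a := by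
  classical
  have hA := I.bidders_nonempty hS.active_nonempty ⟨S.j, hj⟩
  set e : Fin m := ⟨S.j, hj⟩ with he
  set i := (I.bidders S.active e).min' hA with hi
  have him : i ∈ I.bidders S.active e := Finset.min'_mem _ _
  have him' : i ∈ S.active ∧ ∀ k ∈ S.active, I.c i e / I.total i ≤ I.c k e / I.total k := by
    simpa [bidders] using him
  have hz : 0 < S.z e := hS.z_pos e le_rfl
  by_cases hc : I.share i < I.cost i (S.x i) + S.z e * I.c i e
  · have hcost := hS.cost_le i
    have hce : 0 < I.c i e := by
      refine (I.c_nonneg i e).lt_of_ne fun h => ?_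
      rw [← h] at hc
      linarith
    refine ⟨i, e, (I.share i - I.cost i (S.x i)) / I.c i e, ?_⟩
    have hstep : I.step S =
        { x := Function.update S.x i
            (Function.update (S.x i) e ((I.share i - I.cost i (S.x i)) / I.c i e))
          active := S.active.erase i
          z := Function.update S.z e (S.z e - (I.share i - I.cost i (S.x i)) / I.c i e)
          j := S.j
          takes := if 0 < (I.share i - I.cost i (S.x i)) / I.c i e
            then S.takes ++ [(i, e)] else S.takes } := by
      rw [step, dif_pos hj, dif_pos hA]
      exact if_pos hc
    rw [hstep]
    refine ⟨rfl, him'.1, him'.2, div_nonneg (by linarith) hce.le, rfl, rfl, rfl, Or.inr ?_⟩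
    refine ⟨?_, by congr!, rfl, hce, ?_⟩
    · rw [div_lt_iff₀ hce]; linarith
    · field_simp; ring
  · refine ⟨i, e, S.z e, ?_⟩
    have hstep : I.step S =
        { x := Function.update S.x i (Function.update (S.x i) e (S.z e))
          active := S.active
          z := Function.update S.z e 0
          j := S.j + 1
          takes := if 0 < S.z e then S.takes ++ [(i, e)] else S.takes } := by
      rw [step, dif_pos hj, dif_pos hA]
      exact if_neg hc
    rw [hstep]
    refine ⟨rfl, him'.1, him'.2, hz.le, rfl, by simp, rfl, Or.inl ?_⟩
    exact ⟨rfl, rfl, rfl, not_lt.1 hc⟩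

lemma cost_update (i : Fin n) (y : Fin m → ℝ) (e : Fin m) (a : ℝ) (h : y e = 0) :
    I.cost i (Function.update y e a) = I.cost i y + a * I.c i e := by
  classical
  rw [cost, cost, ← Finset.add_sum_erase _ _ (Finset.mem_univ e),
    ← Finset.add_sum_erase Finset.univ (fun e => y e * I.c i e) (Finset.mem_univ e)]
  have : ∑ f ∈ Finset.univ.erase e, Function.update y e a f * I.c i f =
      ∑ f ∈ Finset.univ.erase e, y f * I.c i f :=
    Finset.sum_congr rfl fun f hf => by rw [Function.update_of_ne (Finset.ne_of_mem_erase hf)]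
  rw [this]
  simp [h]
  ring

/-- The last active agent can take the rest of the current item without exceeding her share. -/
lemma erase_nonempty_of_isTake {S S' : FBTAState n m} {i : Fin n} {e : Fin m} {a : ℝ}
    (hS : I.Valid S) (h : I.IsTake S S' i e a) (ha : a < S.z e) (hc : 0 < I.c i e)
    (hcost : I.cost i (S.x i) + a * I.c i e = I.share i) : (S.active.erase i).Nonempty := by
  classical
  by_contra hne
  rw [Finset.not_nonempty_iff_eq_empty] at hne
  have hact : ∀ k, k ≠ i → k ∉ S.active := by
    intro k hk hka
    have : k ∈ S.active.erase i := Finset.mem_erase.2 ⟨hk, hka⟩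
    simp [hne] at this
  have htot : 0 < I.total i :=
    hc.trans_le (Finset.single_le_sum (f := fun e => I.c i e) (fun f _ => I.c_nonneg i f)
      (Finset.mem_univ e))
  -- An inactive `k` has spent exactly the fraction `w k` of her total, and relative to totals no
  -- piece she took is cheaper for the active agent `i` than for her.
  have hw : ∀ k, k ≠ i → I.w k ≤ I.cost i (S.x k) / I.total i := by
    intro k hk
    obtain ⟨h1, h2⟩ := hS.cost_inactive k (hact k hk)
    have : I.w k = I.cost k (S.x k) / I.total k := by
      rw [h1, share]; field_simp
    rw [this, cost, cost, Finset.sum_div, Finset.sum_div]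
    refine Finset.sum_le_sum fun f _ => ?_
    rw [mul_div_assoc, mul_div_assoc]
    rcases (hS.x_nonneg k f).eq_or_lt with h0 | h0
    · simp [← h0]
    · exact mul_le_mul_of_nonneg_left (hS.le_ratio i h.mem k f h0) h0.le
  have hwi : I.w i < (I.cost i (S.x i) + S.z e * I.c i e) / I.total i := by
    rw [lt_div_iff₀ htot]
    have : I.w i * I.total i = I.share i := rfl
    rw [this, ← hcost]
    nlinarith
  have hsum : ∑ k, I.cost i (S.x k) + S.z e * I.c i e ≤ I.total i := by
    simp only [cost]
    rw [Finset.sum_comm]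
    simp only [← Finset.sum_mul]
    have hz : ∀ f, ∑ k, S.x k f = 1 - S.z f := fun f => by rw [hS.z_eq f]; ring
    simp only [hz]
    rw [total, ← Finset.add_sum_erase _ _ (Finset.mem_univ e),
      ← Finset.add_sum_erase Finset.univ (fun e => I.c i e) (Finset.mem_univ e)]
    have : ∑ f ∈ Finset.univ.erase e, (1 - S.z f) * I.c i f ≤
        ∑ f ∈ Finset.univ.erase e, I.c i f := by
      refine Finset.sum_le_sum fun f _ => ?_
      have hzf : 0 ≤ S.z f := by
        rcases lt_or_ge (f : ℕ) S.j with h' | h'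
        · exact (hS.z_done f h').ge
        · exact (hS.z_pos f h').le
      nlinarith [I.c_nonneg i f]
    linarith
  -- In the normalised costs of `i`, all bundles and the rest of `e` weigh at most 1, but agent by
  -- agent they outweigh the `w k`, strictly so for `i`.
  have h1 : (1 : ℝ) < 1 := by
    calc (1 : ℝ) = ∑ k, I.w k := I.w_sum.symm
      _ = I.w i + ∑ k ∈ Finset.univ.erase i, I.w k :=
        (Finset.add_sum_erase _ _ (Finset.mem_univ i)).symm
      _ < (I.cost i (S.x i) + S.z e * I.c i e) / I.total i +
          ∑ k ∈ Finset.univ.erase i, I.cost i (S.x k) / I.total i :=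
        add_lt_add_of_lt_of_le hwi
          (Finset.sum_le_sum fun k hk => hw k (Finset.ne_of_mem_erase hk))
      _ = (∑ k, I.cost i (S.x k) + S.z e * I.c i e) / I.total i := by
        rw [← Finset.add_sum_erase Finset.univ (fun k => I.cost i (S.x k)) (Finset.mem_univ i),
          ← Finset.sum_div]
        ring
      _ ≤ 1 := (div_le_one htot).2 hsum
  exact lt_irrefl _ h1

lemma valid_initState : I.Valid (initState n m) where
  j_le := Nat.zero_le _
  active_nonempty := by
    rw [initState, Finset.univ_nonempty_iff]
    by_contra h
    rw [not_nonempty_iff] at h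
    simpa using I.w_sum
  x_nonneg _ _ := le_rfl
  x_later _ _ _ := rfl
  x_active _ _ _ _ := rfl
  z_eq := by simp [initState]
  z_done e h := by simp [initState] at h
  z_pos e h := by simp [initState]
  cost_le i := by
    simpa [cost, initState, share, total] using
      mul_nonneg (I.w_pos i).le (Finset.sum_nonneg fun e _ => I.c_nonneg i e)
  cost_inactive := by simp [initState]
  le_ratio := by simp [initState]
  mem_takes := by simp [initState]

lemma Valid.of_isTake {I : ChoreInstance n m} {S S' : FBTAState n m} {i : Fin n} {e : Fin m}
    {a : ℝ} (hS : I.Valid S) (h : I.IsTake S S' i e a) : I.Valid S' := by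
  classical
  have hxie : S.x i e = 0 := hS.x_active i h.mem e h.item_eq.ge
  have hxi : S'.x i = Function.update (S.x i) e a := by rw [h.x_eq]; simp
  have hxk : ∀ k, k ≠ i → S'.x k = S.x k := fun k hk => by
    rw [h.x_eq, Function.update_of_ne hk]
  have hxf : ∀ k f, f ≠ e → S'.x k f = S.x k f := by
    intro k f hf
    by_cases hk : k = i
    · subst hk; rw [hxi, Function.update_of_ne hf]
    · rw [hxk k hk]
  have hxe : S'.x i e = a := by rw [hxi]; simp
  have hze : S'.z e = S.z e - a := by rw [h.z_eq]; simp
  have hzf : ∀ f, f ≠ e → S'.z f = S.z f := fun f hf => by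
    rw [h.z_eq, Function.update_of_ne hf]
  have hcost : I.cost i (S'.x i) = I.cost i (S.x i) + a * I.c i e := by
    rw [hxi, I.cost_update i _ e a hxie]
  have hjle : S.j ≤ S'.j := by rcases h.cases with h' | h' <;> omega
  have hsub : S'.active ⊆ S.active := by
    rcases h.cases with h' | h'
    · rw [h'.2.1]
    · rw [h'.2.1]; exact Finset.erase_subset _ _
  have hem := e.2
  have hei := h.item_eq
  refine ⟨?_, ?_, ?_, ?_, ?_, ?_, ?_, ?_, ?_, ?_, ?_, ?_⟩
  · have := hS.j_le
    rcases h.cases with h' | h' <;> omega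
  · rcases h.cases with h' | h'
    · rw [h'.2.1]; exact hS.active_nonempty
    · rw [h'.2.1]
      exact I.erase_nonempty_of_isTake hS h h'.1 h'.2.2.2.1 h'.2.2.2.2
  · intro k f
    by_cases hf : f = e
    · subst hf
      by_cases hk : k = i
      · subst hk; rw [hxe]; exact h.nonneg
      · rw [hxk k hk]; exact hS.x_nonneg k f
    · rw [hxf k f hf]; exact hS.x_nonneg k f
  · intro k f hf
    have : f ≠ e := fun h0 => by subst h0; omega
    rw [hxf k f this]
    exact hS.x_later k f (by omega)
  · intro k hk f hf
    by_cases hfe : f = e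
    · subst hfe
      rcases h.cases with h' | h'
      · omega
      · rw [h'.2.1] at hk
        rw [hxk k (Finset.ne_of_mem_erase hk)]
        exact hS.x_active k (Finset.mem_of_mem_erase hk) f (by omega)
    · rw [hxf k f hfe]; exact hS.x_active k (hsub hk) f (by omega)
  · intro f
    by_cases hfe : f = e
    · subst hfe
      rw [hze, hS.z_eq f, ← Finset.add_sum_erase _ _ (Finset.mem_univ i),
        ← Finset.add_sum_erase Finset.univ (fun k => S'.x k f) (Finset.mem_univ i), hxie, hxe,
        Finset.sum_congr rfl fun k hk => show S'.x k f = S.x k f by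
          rw [hxk k (Finset.ne_of_mem_erase hk)]]
      ring
    · rw [hzf f hfe, hS.z_eq f]
      simp only [hxf _ f hfe]
  · intro f hf
    by_cases hfe : f = e
    · subst hfe
      rcases h.cases with h' | h'
      · rw [hze, h'.1]; ring
      · omega
    · rw [hzf f hfe]
      refine hS.z_done f ?_
      have : (f : ℕ) ≠ e := fun h0 => hfe (Fin.ext h0)
      rcases h.cases with h' | h' <;> omega
  · intro f hf
    by_cases hfe : f = e
    · subst hfe
      rcases h.cases with h' | h'
      · omega
      · rw [hze]; linarith [h'.1]
    · rw [hzf f hfe]; exact hS.z_pos f (by omega)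
  · intro k
    by_cases hk : k = i
    · subst hk
      rw [hcost]
      rcases h.cases with h' | h'
      · exact h'.2.2.2
      · exact h'.2.2.2.2.le
    · rw [hxk k hk]; exact hS.cost_le k
  · intro k hk
    by_cases hki : k = i
    · subst hki
      rcases h.cases with h' | h'
      · rw [h'.2.1] at hk; exact absurd h.mem hk
      · exact ⟨hcost.trans h'.2.2.2.2, h'.2.2.2.1.trans_le
          (Finset.single_le_sum (f := fun e => I.c k e) (fun f _ => I.c_nonneg k f)
            (Finset.mem_univ e))⟩
    · rw [hxk k hki]
      refine hS.cost_inactive k fun hka => hk ?_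
      rcases h.cases with h' | h'
      · rwa [h'.2.1]
      · rw [h'.2.1]; exact Finset.mem_erase.2 ⟨hki, hka⟩
  · intro k hk l f hl
    by_cases hf : f = e
    · subst hf
      by_cases hli : l = i
      · subst hli; exact h.le_ratio k (hsub hk)
      · rw [hxk l hli] at hl; exact hS.le_ratio k (hsub hk) l f hl
    · rw [hxf l f hf] at hl; exact hS.le_ratio k (hsub hk) l f hl
  · intro k f
    have hmem : (k, f) ∈ S'.takes ↔ (k, f) ∈ S.takes ∨ (0 < a ∧ k = i ∧ f = e) := by
      rw [h.takes_eq]; split_ifs with ha <;> simp [ha]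
    rw [hmem, hS.mem_takes]
    by_cases hf : f = e
    · subst hf
      by_cases hk : k = i
      · subst hk; rw [hxie, hxe]; simp
      · rw [hxk k hk]; simp [hk]
    · rw [hxf k f hf]; simp [hf]

lemma step_eq_self {S : FBTAState n m} (hj : ¬ S.j < m) : I.step S = S := by
  rw [step, dif_neg hj]

lemma valid_iterate (t : ℕ) : I.Valid (I.step^[t] (initState n m)) := by
  induction t with
  | zero => exact I.valid_initState
  | succ t ih =>
    rw [Function.iterate_succ_apply']
    by_cases hj : (I.step^[t] (initState n m)).j < m
    · obtain ⟨i, e, a, h⟩ := I.isTake_step ih hj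
      exact ih.of_isTake h
    · rwa [I.step_eq_self hj]

lemma valid_final : I.Valid I.final := I.valid_iterate _

/-- As long as items remain, every iteration removes an active agent or advances `j`, so |active| -
j ≤ n - t after t iterations. Since an agent always stays active, this fails at t = n + m. -/
lemma final_j : I.final.j = m := by
  classical
  have key : ∀ t, (I.step^[t] (initState n m)).j = m ∨
      (I.step^[t] (initState n m)).active.card + m + t ≤
        n + m + (I.step^[t] (initState n m)).j := by
    intro t
    induction t with
    | zero => right; simp [initState]
    | succ t ih =>
      have hv := I.valid_iterate t
      rw [Function.iterate_succ_apply']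
      by_cases hj : (I.step^[t] (initState n m)).j < m
      · obtain ⟨i, e, a, h⟩ := I.isTake_step hv hj
        right
        have ih' := ih.resolve_left hj.ne
        rcases h.cases with h' | h'
        · rw [h'.2.1, h'.2.2.1]; omega
        · rw [h'.2.1, h'.2.2.1, Finset.card_erase_of_mem h.mem]
          have := Finset.card_pos.2 ⟨i, h.mem⟩
          omega
      · rw [I.step_eq_self hj]
        exact Or.inl (le_antisymm hv.j_le (not_lt.1 hj))
  rcases key (n + m) with h | h
  · exact h
  · have h1 := Finset.card_pos.2 I.valid_final.active_nonempty
    have h2 := I.valid_final.j_le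
    rw [final] at *
    omega

lemma x_nonneg (i : Fin n) (e : Fin m) : 0 ≤ I.x i e := I.valid_final.x_nonneg i e

lemma sum_x (e : Fin m) : ∑ i, I.x i e = 1 := by
  have h1 := I.valid_final.z_eq e
  rw [I.valid_final.z_done e (by rw [I.final_j]; exact e.2)] at h1
  simp only [x]
  linarith

lemma cost_x_le (i : Fin n) : I.cost i (I.x i) ≤ I.share i := I.valid_final.cost_le i

/-! ### The sharing graph as a forest directed towards its roots. -/

/-- The edges recorded in a state of the algorithm. -/
def HasEdge (S : FBTAState n m) (i : Fin n) (e : Fin m) (k : Fin n) : Prop :=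
  [(i, e), (k, e)] <:+: S.takes

lemma pair_infix_concat {α : Type*} (l : List α) (a b c : α) :
    [a, b] <:+: l ++ [c] ↔ [a, b] <:+: l ∨ (b = c ∧ l.getLast? = some a) := by
  rw [List.infix_concat_iff]
  constructor
  · rintro (⟨t, ht⟩ | h)
    · right
      have h1 : (t ++ [a]) ++ [b] = l ++ [c] := by simpa using ht
      obtain ⟨h2, h3⟩ := List.append_inj' h1 rfl
      exact ⟨by simpa using h3, by simp [← h2]⟩
    · exact Or.inl h
  · rintro (h | ⟨rfl, h⟩)
    · exact Or.inr h
    · left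
      obtain ⟨t, rfl⟩ := List.getLast?_eq_some_iff.1 h
      exact ⟨t, by simp⟩

/-- The combinatorial invariants of the algorithm. -/
structure Forest (S : FBTAState n m) : Prop where
  tail_inactive : ∀ i e k, HasEdge S i e k → i ∉ S.active
  tail_unique : ∀ i e f k l, HasEdge S i e k → HasEdge S i f l → e = f
  ne : ∀ i e k, HasEdge S i e k → i ≠ k
  last : ∀ p, S.takes.getLast? = some p → ∀ f k, ¬ HasEdge S p.1 f k
  tail_or_tail : ∀ i k e, (i, e) ∈ S.takes → (k, e) ∈ S.takes → i ≠ k →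
    (∃ l, HasEdge S i e l) ∨ ∃ l, HasEdge S k e l
  current : ∀ i e, (i, e) ∈ S.takes → (e : ℕ) = S.j → i ∉ S.active ∧
    ((∃ l, HasEdge S i e l) ∨ S.takes.getLast? = some (i, e))
  exists_root : ∀ v, ∃ r, Relation.ReflTransGen (fun i k => ∃ e, HasEdge S i e k) v r ∧
    ∀ e k, ¬ HasEdge S r e k

lemma forest_initState : Forest (initState n m) := by
  have h : ∀ i e k, ¬ HasEdge (initState n m) i e k := by
    intro i e k h
    simp [HasEdge, initState] at h
  exact ⟨fun i e k h' => (h i e k h').elim, fun i e f k l h' => (h i e k h').elim,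
    fun i e k h' => (h i e k h').elim, fun p _ f k => h _ _ _, by simp [initState],
    by simp [initState], fun v => ⟨v, .refl, h v⟩⟩

/-- The only possible new edge leads from the last recorded taker, if she took from the same item,
to `i`. That taker is inactive and has no outgoing edge so far; `i` is active and hence is not a
tail. So out-edges stay unique, and a walk that used to end at the last taker is prolonged to the
new root `i`. A take of fraction zero records nothing. -/
lemma Forest.of_isTake {I : ChoreInstance n m} {S S' : FBTAState n m} {i : Fin n} {e : Fin m}
    {a : ℝ} (hS : I.Valid S) (hF : Forest S) (h : I.IsTake S S' i e a) : Forest S' := by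
  classical
  have hsub : S'.active ⊆ S.active := by
    rcases h.cases with h' | h'
    · rw [h'.2.1]
    · rw [h'.2.1]; exact Finset.erase_subset _ _
  have hv' := hS.of_isTake h
  have hcur : ∀ k f, (k, f) ∈ S.takes → (f : ℕ) ≤ S.j := by
    intro k f hk
    by_contra hlt
    rw [hS.mem_takes, hS.x_later k f (by omega)] at hk
    exact lt_irrefl _ hk
  have hnot : (i, e) ∉ S.takes := by
    rw [hS.mem_takes, hS.x_active i h.mem e h.item_eq.ge]; exact lt_irrefl _
  have hact : ∀ k f, (k, f) ∈ S'.takes → (f : ℕ) = S'.j → k ∉ S'.active := by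
    intro k f hk hf hka
    rw [hv'.mem_takes, hv'.x_active k hka f hf.ge] at hk
    exact lt_irrefl _ hk
  by_cases ha : 0 < a
  · have ht : S'.takes = S.takes ++ [(i, e)] := by rw [h.takes_eq, if_pos ha]
    have hE : ∀ k f l, HasEdge S' k f l ↔
        HasEdge S k f l ∨ (l = i ∧ f = e ∧ S.takes.getLast? = some (k, e)) := by
      intro k f l
      rw [HasEdge, ht, pair_infix_concat, HasEdge, Prod.mk.injEq, and_assoc]
      constructor
      · rintro (h1 | ⟨h1, rfl, h2⟩)
        · exact Or.inl h1
        · exact Or.inr ⟨h1, rfl, h2⟩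
      · rintro (h1 | ⟨h1, rfl, h2⟩)
        · exact Or.inl h1
        · exact Or.inr ⟨h1, rfl, h2⟩
    have hlast : ∀ k, S.takes.getLast? = some (k, e) → k ∉ S.active := fun k hk =>
      (hF.current k e (List.mem_of_getLast? hk) h.item_eq).1
    have hi : ∀ f l, ¬ HasEdge S i f l := fun f l hl => hF.tail_inactive i f l hl h.mem
    have hi' : ∀ f l, ¬ HasEdge S' i f l := by
      intro f l hl
      rcases (hE i f l).1 hl with hl | ⟨-, -, hl⟩
      · exact hi f l hl
      · exact hlast i hl h.mem
    have hmono : ∀ k f l, HasEdge S k f l → HasEdge S' k f l := fun k f l hk =>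
      (hE k f l).2 (Or.inl hk)
    have hcurE : ∀ k, (k, e) ∈ S.takes → ∃ l, HasEdge S' k e l := by
      intro k hk
      rcases (hF.current k e hk h.item_eq).2 with ⟨l, hl⟩ | hl
      · exact ⟨l, hmono _ _ _ hl⟩
      · exact ⟨i, (hE _ _ _).2 (Or.inr ⟨rfl, rfl, hl⟩)⟩
    refine ⟨?_, ?_, ?_, ?_, ?_, ?_, ?_⟩
    · intro k f l hk hka
      rcases (hE k f l).1 hk with hk | ⟨-, -, hk⟩
      · exact hF.tail_inactive k f l hk (hsub hka)
      · exact hlast k hk (hsub hka)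
    · intro k f g l l' h1 h2
      rcases (hE k f l).1 h1 with h1 | ⟨-, h1', h1⟩ <;>
        rcases (hE k g l').1 h2 with h2 | ⟨-, h2', h2⟩
      · exact hF.tail_unique k f g l l' h1 h2
      · exact (hF.last _ h2 f l h1).elim
      · exact (hF.last _ h1 g l' h2).elim
      · exact h1'.trans h2'.symm
    · intro k f l hk
      rcases (hE k f l).1 hk with hk | ⟨hl, -, hk'⟩
      · exact hF.ne k f l hk
      · rintro rfl; exact hlast k hk' (hl ▸ h.mem)
    · intro p hp f k
      rw [ht, List.getLast?_concat, Option.some_inj] at hp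
      subst hp
      exact hi' f k
    · intro k l f hk hl hkl
      rw [ht, List.mem_append, List.mem_singleton, Prod.mk.injEq] at hk hl
      rcases hk with hk | ⟨rfl, rfl⟩
      · rcases hl with hl | ⟨rfl, rfl⟩
        · rcases hF.tail_or_tail k l f hk hl hkl with ⟨o, ho⟩ | ⟨o, ho⟩
          · exact Or.inl ⟨o, hmono _ _ _ ho⟩
          · exact Or.inr ⟨o, hmono _ _ _ ho⟩
        · exact Or.inl (hcurE k hk)
      · rcases hl with hl | ⟨rfl, -⟩
        · exact Or.inr (hcurE l hl)
        · exact absurd rfl hkl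
    · intro k f hk hf
      refine ⟨hact k f hk hf, ?_⟩
      rw [ht, List.mem_append, List.mem_singleton, Prod.mk.injEq] at hk
      rcases hk with hk | ⟨rfl, rfl⟩
      · have hfe : f = e := by
          have h1 := hcur k f hk
          have h2 := h.item_eq
          refine Fin.ext ?_
          rcases h.cases with h' | h' <;> omega
        subst hfe
        exact Or.inl (hcurE k hk)
      · right; rw [ht]; simp
    · intro v
      obtain ⟨r, hr, hroot⟩ := hF.exists_root v
      have hr' : Relation.ReflTransGen (fun i k => ∃ e, HasEdge S' i e k) v r :=
        Relation.ReflTransGen.mono (fun _ _ ⟨f, hf⟩ => ⟨f, hmono _ _ _ hf⟩) _ _ hr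
      by_cases hl : S.takes.getLast? = some (r, e)
      · exact ⟨i, hr'.tail ⟨e, (hE _ _ _).2 (Or.inr ⟨rfl, rfl, hl⟩)⟩, hi'⟩
      · refine ⟨r, hr', fun f k hk => ?_⟩
        rcases (hE r f k).1 hk with hk | ⟨-, -, hk⟩
        · exact hroot f k hk
        · exact hl hk
  · have ht : S'.takes = S.takes := by rw [h.takes_eq, if_neg ha]
    have hE : ∀ k f l, HasEdge S' k f l ↔ HasEdge S k f l := by
      intro k f l; rw [HasEdge, ht, HasEdge]
    refine ⟨?_, ?_, ?_, ?_, ?_, ?_, ?_⟩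
    · intro k f l hk hka
      exact hF.tail_inactive k f l ((hE _ _ _).1 hk) (hsub hka)
    · simpa only [hE] using hF.tail_unique
    · simpa only [hE] using hF.ne
    · simpa only [hE, ht] using hF.last
    · simpa only [hE, ht] using hF.tail_or_tail
    · intro k f hk hf
      refine ⟨hact k f hk hf, ?_⟩
      rw [ht] at hk
      have h1 := hcur k f hk
      simp only [hE, ht]
      refine (hF.current k f hk ?_).2
      rcases h.cases with h' | h' <;> omega
    · simpa only [hE] using hF.exists_root

lemma forest_final : Forest I.final := by
  have key : ∀ t, Forest (I.step^[t] (initState n m)) := by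
    intro t
    induction t with
    | zero => exact forest_initState
    | succ t ih =>
      rw [Function.iterate_succ_apply']
      by_cases hj : (I.step^[t] (initState n m)).j < m
      · obtain ⟨i, e, a, h⟩ := I.isTake_step (I.valid_iterate t) hj
        exact Forest.of_isTake (I.valid_iterate t) ih h
      · rwa [I.step_eq_self hj]
  exact key _

end ChoreInstance

/-! ### Rounding an abstract fractional allocation: total excess and its subadditivity. -/

namespace Rounding

/-- A fractional allocation `x` of the items `κ` to the agents `ι`, with costs `c` in `[0, 1]`. -/
structure IsFractional {ι κ : Type*} [Fintype ι] (x c : ι → κ → ℝ) : Prop where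
  nonneg : ∀ i e, 0 ≤ x i e
  sum_eq : ∀ e, ∑ i, x i e = 1
  cost_nonneg : ∀ i e, 0 ≤ c i e
  cost_le : ∀ i e, c i e ≤ 1

variable {ι κ : Type*} [Fintype ι] {x c : ι → κ → ℝ}

open scoped Classical in
/-- The agents with a positive fraction of `e`. -/
def support (x : ι → κ → ℝ) (e : κ) : Finset ι := {i | 0 < x i e}

lemma mem_support {e : κ} {i : ι} : i ∈ support x e ↔ 0 < x i e := by simp [support]

lemma exists_pos (hx : IsFractional x c) (e : κ) : ∃ i, 0 < x i e := by
  by_contra! h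
  have : ∑ i, x i e ≤ 0 := Finset.sum_nonpos fun i _ => h i
  rw [hx.sum_eq] at this
  linarith

lemma sum_support (hx : IsFractional x c) (e : κ) : ∑ i ∈ support x e, x i e = 1 := by
  rw [← hx.sum_eq e]
  refine Finset.sum_subset (Finset.subset_univ _) fun i _ hi => ?_
  rw [mem_support, not_lt] at hi
  exact le_antisymm hi (hx.nonneg i e)

lemma x_le_one (hx : IsFractional x c) (i : ι) (e : κ) : x i e ≤ 1 := by
  rw [← hx.sum_eq e]
  exact Finset.single_le_sum (f := fun i => x i e) (fun i _ => hx.nonneg i e) (Finset.mem_univ i)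

variable [DecidableEq ι]

/-- The change of the cost of agent `i` when item `e` is given to `X e`. -/
def change (x c : ι → κ → ℝ) (X : κ → ι) (i : ι) (e : κ) : ℝ :=
  ((if X e = i then 1 else 0) - x i e) * c i e

/-- The items in `F` can be rounded such that the total increase of the costs of the agents is
at most `β`. -/
def RoundsWithin (x c : ι → κ → ℝ) (F : Finset κ) (β : ℝ) : Prop :=
  ∃ X : κ → ι, (∀ e ∈ F, 0 < x (X e) e) ∧ ∑ i, max (∑ e ∈ F, change x c X i e) 0 ≤ β

lemma RoundsWithin.mono {F : Finset κ} {β γ : ℝ} (h : RoundsWithin x c F β) (hβ : β ≤ γ) :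
    RoundsWithin x c F γ := by
  obtain ⟨X, h1, h2⟩ := h
  exact ⟨X, h1, h2.trans hβ⟩

lemma roundsWithin_empty (hx : IsFractional x c) : RoundsWithin x c ∅ 0 :=
  ⟨fun e => (exists_pos hx e).choose, by simp, by simp⟩

variable [DecidableEq κ]

/-- The positive part is subadditive, so disjoint groups of items can be rounded independently. -/
lemma RoundsWithin.union {F G : Finset κ} {β γ : ℝ} (hF : RoundsWithin x c F β)
    (hG : RoundsWithin x c G γ) (hd : Disjoint F G) : RoundsWithin x c (F ∪ G) (β + γ) := by
  obtain ⟨X, h1, h2⟩ := hF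
  obtain ⟨Y, h3, h4⟩ := hG
  have hG' : ∀ e ∈ G, e ∉ F := fun e he he' => Finset.disjoint_left.1 hd he' he
  refine ⟨fun e => if e ∈ F then X e else Y e, fun e he => ?_, ?_⟩
  · by_cases h : e ∈ F
    · simpa [h] using h1 e h
    · simpa [h] using h3 e ((Finset.mem_union.1 he).resolve_left h)
  · refine le_trans ?_ (add_le_add h2 h4)
    rw [← Finset.sum_add_distrib]
    refine Finset.sum_le_sum fun i _ => ?_
    rw [Finset.sum_union hd]
    have e1 : ∑ e ∈ F, change x c (fun e => if e ∈ F then X e else Y e) i e =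
        ∑ e ∈ F, change x c X i e :=
      Finset.sum_congr rfl fun e he => by simp [change, he]
    have e2 : ∑ e ∈ G, change x c (fun e => if e ∈ F then X e else Y e) i e =
        ∑ e ∈ G, change x c Y i e :=
      Finset.sum_congr rfl fun e he => by simp [change, hG' e he]
    rw [e1, e2]
    exact max_le (add_le_add (le_max_left _ _) (le_max_left _ _))
      (add_nonneg (le_max_right _ _) (le_max_right _ _))

lemma roundsWithin_biUnion (hx : IsFractional x c) {α : Type*} [DecidableEq α] (s : Finset α)
    (F : α → Finset κ) (β : α → ℝ) (h : ∀ a ∈ s, RoundsWithin x c (F a) (β a))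
    (hd : (s : Set α).PairwiseDisjoint F) : RoundsWithin x c (s.biUnion F) (∑ a ∈ s, β a) := by
  induction s using Finset.induction_on with
  | empty => simpa using roundsWithin_empty hx
  | insert a s ha ih =>
    rw [Finset.biUnion_insert, Finset.sum_insert ha]
    refine (h a (Finset.mem_insert_self _ _)).union
      (ih (fun b hb => h b (Finset.mem_insert_of_mem hb))
        (hd.subset (Finset.coe_subset.2 (Finset.subset_insert _ _)))) ?_
    rw [Finset.disjoint_biUnion_right]
    intro b hb
    exact hd (by simp) (by simp [hb]) (fun hab => ha (hab ▸ hb))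

/-! ### Real inequalities for one satellite. -/

/-- The least excess of an agent who does not receive the central item, of which she holds `a` at
cost `C`, and of the second holder of a further item, of which she holds `b` at cost `D`. -/
def lossBound (a b C D : ℝ) : ℝ := min b (max ((1 - b) * D - a * C) 0)

/-- The same when the agent receives the central item. -/
def gainBound (a b C D : ℝ) : ℝ :=
  min (b + max ((1 - a) * C - b * D) 0) ((1 - a) * C + (1 - b) * D)

/-- The average of the two, when the central item is given away with the probabilities `x`. -/
def satelliteBound (a b C D : ℝ) : ℝ := a * gainBound a b C D + (1 - a) * lossBound a b C D

/-- The smaller of b(1-D) and (1-b)D is at most D(1-D) ≤ 1/4. -/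
lemma min_bound {b D R t : ℝ} (hD : 0 ≤ D) (hD' : D ≤ 1) (h1 : R ≤ t + b * (1 - D)) (h2 : R ≤ t + (1 - b) * D) :
    R ≤ t + 1 / 4 := by
  rcases le_total b D with h | h
  · nlinarith [sq_nonneg (D - 1 / 2), mul_nonneg (sub_nonneg.2 h) (sub_nonneg.2 hD')]
  · nlinarith [sq_nonneg (D - 1 / 2), mul_nonneg (sub_nonneg.2 h) hD]

/-- The signs of the two differences under `max` give four cases. In each, the minima are bounded by
fixed choices of who gets the satellite. -/
lemma satelliteBound_le_half {a b C D : ℝ} (ha : 0 ≤ a) (ha' : a ≤ 1) (hb : 0 ≤ b) (hb' : b ≤ 1)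
    (hC' : C ≤ 1) (hD : 0 ≤ D) (hD' : D ≤ 1) : satelliteBound a b C D ≤ 1 / 2 := by
  have hL1 : lossBound a b C D ≤ b := min_le_left _ _
  have hL2 : lossBound a b C D ≤ max ((1 - b) * D - a * C) 0 := min_le_right _ _
  have hR1 : gainBound a b C D ≤ b + max ((1 - a) * C - b * D) 0 := min_le_left _ _
  have hR2 : gainBound a b C D ≤ (1 - a) * C + (1 - b) * D := min_le_right _ _
  have haC : (1 - a) * C ≤ 1 - a := by nlinarith
  have hbD : (1 - b) * D ≤ 1 - b := by nlinarith
  rw [satelliteBound]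
  generalize gainBound a b C D = R at *
  generalize lossBound a b C D = L at *
  have hR2' := mul_le_mul_of_nonneg_left hR2 ha
  have hL1' := mul_le_mul_of_nonneg_left hL1 (sub_nonneg.2 ha')
  rcases le_total ((1 - b) * D) (a * C) with h1 | h1
  · rw [max_eq_right (by linarith)] at hL2
    have hL2' := mul_le_mul_of_nonneg_left hL2 (sub_nonneg.2 ha')
    rcases le_total ((1 - a) * C) (b * D) with h2 | h2
    · rw [max_eq_right (by linarith)] at hR1
      have : a * (R + R) ≤ a * (2 - a) := mul_le_mul_of_nonneg_left (by linarith) ha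
      nlinarith [sq_nonneg (a - 1)]
    · rw [max_eq_left (by linarith)] at hR1
      have hR : R ≤ (1 - a) * C + 1 / 4 := min_bound (b := b) hD hD' (by linarith) (by linarith)
      have : a * R ≤ a * (1 - a + 1 / 4) := mul_le_mul_of_nonneg_left (by linarith) ha
      nlinarith [sq_nonneg (a - 5 / 8)]
  · rw [max_eq_left (by linarith)] at hL2
    have hL2' := mul_le_mul_of_nonneg_left hL2 (sub_nonneg.2 ha')
    rcases le_total ((1 - a) * C) (b * D) with h2 | h2
    · rw [max_eq_right (by linarith)] at hR1
      have hR1' := mul_le_mul_of_nonneg_left hR1 ha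
      rcases le_total b (1 / 2) with h3 | h3
      · linarith
      · linarith
    · rw [max_eq_left (by linarith)] at hR1
      have hR1' := mul_le_mul_of_nonneg_left hR1 ha
      -- Three strategies for the satellite: the agent always keeps it (`s1`), never keeps it
      -- (`s2`), or gives it up exactly when she receives the central item (`s3`).
      have s1 : a * R + (1 - a) * L ≤ (1 - b) * D := by linarith
      have s2 : a * R + (1 - a) * L ≤ b + a * ((1 - a) * C) - a * b * D := by linarith
      have s3 : a * R + (1 - a) * L ≤ a * b + D * (1 - a - b) := by linarith
      have s2' : a * ((1 - a) * C) ≤ a * (1 - a) := mul_le_mul_of_nonneg_left haC ha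
      rcases le_total b (1 / 2) with h3 | h3
      swap
      · linarith
      rcases le_total D (1 / 2) with h4 | h4
      · nlinarith
      rcases le_total (1 - a - b) 0 with h5 | h5
      · nlinarith
      rcases le_total (1 / 2) a with h6 | h6
      · nlinarith
      -- In the sum of `s2` and `s3` the coefficient of D is 1-a-b-ab; its sign decides whether D =
      -- 1 or D = 1/2 is the worst case.
      rcases le_total 0 (1 - a - b - a * b) with h7 | h7
      · nlinarith [mul_nonneg h7 (sub_nonneg.2 hD')]
      · nlinarith [mul_nonneg (neg_nonneg.2 h7) (sub_nonneg.2 h4), sq_nonneg (a - 3 / 8),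
          mul_nonneg ha (sub_nonneg.2 h3)]

/-- The term a(1-a) is the contribution of the other holder of a central item with two holders. The
assumption D ≤ C means that the item costlier to the common holder is taken as the centre. The
constant comes from 1/2 + a - 3a²/2, which is maximal at a = 1/3. -/
lemma satelliteBound_add_le {a b C D : ℝ} (ha : 0 ≤ a) (ha' : a ≤ 1) (hb : 0 ≤ b) (hb' : b ≤ 1)
    (hC' : C ≤ 1) (hD : 0 ≤ D) (hCD : D ≤ C) :
    satelliteBound a b C D + a * (1 - a) ≤ 2 / 3 := by
  have hL1 : lossBound a b C D ≤ b := min_le_left _ _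
  have hL2 : lossBound a b C D ≤ max ((1 - b) * D - a * C) 0 := min_le_right _ _
  have hR1 : gainBound a b C D ≤ b + max ((1 - a) * C - b * D) 0 := min_le_left _ _
  have hR2 : gainBound a b C D ≤ (1 - a) * C + (1 - b) * D := min_le_right _ _
  have hC : 0 ≤ C := hD.trans hCD
  have hD' : D ≤ 1 := hCD.trans hC'
  have haC : (1 - a) * C ≤ 1 - a := by nlinarith
  have hbD : (1 - b) * D ≤ 1 - b := by nlinarith
  rw [satelliteBound]
  generalize gainBound a b C D = R at *
  generalize lossBound a b C D = L at *
  have hR2' := mul_le_mul_of_nonneg_left hR2 ha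
  have hL1' := mul_le_mul_of_nonneg_left hL1 (sub_nonneg.2 ha')
  rcases hC.eq_or_lt with rfl | hCpos
  · have hD0 : D = 0 := le_antisymm hCD hD
    subst hD0
    simp only [mul_zero, sub_zero, max_self, add_zero] at *
    nlinarith [sq_nonneg (a - 1 / 2), mul_le_mul_of_nonneg_left hL2 (sub_nonneg.2 ha')]
  rcases le_total ((1 - b) * D) (a * C) with h1 | h1
  · rw [max_eq_right (by linarith)] at hL2
    have hL2' := mul_le_mul_of_nonneg_left hL2 (sub_nonneg.2 ha')
    rcases le_total ((1 - a) * C) (b * D) with h2 | h2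
    · rw [max_eq_right (by linarith)] at hR1
      have : a * (R + R) ≤ a * (2 - a) := mul_le_mul_of_nonneg_left (by linarith) ha
      nlinarith [sq_nonneg (a - 2 / 3)]
    · rw [max_eq_left (by linarith)] at hR1
      have hR : R ≤ (1 - a) * C + 1 / 4 := min_bound (b := b) hD hD' (by linarith) (by linarith)
      have : a * R ≤ a * (1 - a + 1 / 4) := mul_le_mul_of_nonneg_left (by linarith) ha
      nlinarith [sq_nonneg (a - 9 / 16)]
  · rw [max_eq_left (by linarith)] at hL2
    have hL2' := mul_le_mul_of_nonneg_left hL2 (sub_nonneg.2 ha')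
    -- Here aC ≤ (1-b)D ≤ (1-b)C, by D ≤ C.
    have hab : a ≤ 1 - b := by
      refine le_of_mul_le_mul_right ?_ hCpos
      nlinarith
    rcases le_total ((1 - a) * C) (b * D) with h2 | h2
    · rw [max_eq_right (by linarith)] at hR1
      have hab' : 1 - a ≤ b := by
        refine le_of_mul_le_mul_right ?_ hCpos
        nlinarith
      have hb1 : b = 1 - a := by linarith
      subst hb1
      have hR1' := mul_le_mul_of_nonneg_left hR1 ha
      have hL0 : L ≤ 0 := by nlinarith
      have hL0' := mul_le_mul_of_nonneg_left hL0 (sub_nonneg.2 ha')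
      nlinarith [sq_nonneg (a - 1 / 2)]
    · rw [max_eq_left (by linarith)] at hR1
      have hR1' := mul_le_mul_of_nonneg_left hR1 ha
      have s2 : a * R + (1 - a) * L ≤ b + a * ((1 - a) * C) - a * b * D := by linarith
      have s3 : a * R + (1 - a) * L ≤ a * b + D * (1 - a - b) := by linarith
      have s2' : a * ((1 - a) * C) ≤ a * (1 - a) := mul_le_mul_of_nonneg_left haC ha
      rcases le_total 0 (1 - a - b - a * b) with h7 | h7
      · nlinarith [mul_nonneg h7 (sub_nonneg.2 hD'), sq_nonneg (a - 1 / 3)]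
      · have h8 : a * R + (1 - a) * L ≤ (1 - a) * (1 - b) := by nlinarith
        have h9 : 3 * ((1 - a) * a * (3 + a)) ≤ 2 * (1 + a) := by
          nlinarith [sq_nonneg (a - 1 / 2), mul_nonneg ha (sq_nonneg (a - 1 / 2))]
        have h10 : (1 - a) * (1 + a - b) * (1 + a) ≤ (1 - a) * (a * (3 + a)) := by
          rw [mul_assoc]
          exact mul_le_mul_of_nonneg_left (by nlinarith) (sub_nonneg.2 ha')
        have h11 : (1 - a) * (1 + a - b) * (1 + a) ≤ 2 / 3 * (1 + a) := by linarith
        have := le_of_mul_le_mul_right h11 (by linarith)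
        linarith

end Rounding

/-! ### Stars: a central item with satellites. -/

namespace Rounding

variable {ι κ : Type*} [Fintype ι] [DecidableEq ι] {x c : ι → κ → ℝ}

lemma change_self_le (hx : IsFractional x c) (X : κ → ι) (i : ι) (e : κ) :
    change x c X i e ≤ if X e = i then (1 - x i e) * c i e else 0 := by
  rw [change]
  split_ifs with h
  · exact le_rfl
  · nlinarith [mul_nonneg (hx.nonneg i e) (hx.cost_nonneg i e)]

lemma exists_other_holder (hx : IsFractional x c) {e : κ} {i : ι} (hi : 0 < x i e)
    (he : (support x e).card = 2) : ∃ o, o ≠ i ∧ 0 < x o e ∧ x o e = 1 - x i e := by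
  obtain ⟨o, ho⟩ : ∃ o, (support x e).erase i = {o} := by
    rw [← Finset.card_eq_one, Finset.card_erase_of_mem (mem_support.2 hi), he]
  have h1 : o ∈ (support x e).erase i := by simp [ho]
  have h2 := sum_support hx e
  rw [← Finset.add_sum_erase _ _ (mem_support.2 hi), ho, Finset.sum_singleton] at h2
  exact ⟨o, (Finset.mem_erase.1 h1).1, mem_support.1 (Finset.mem_erase.1 h1).2, by linarith⟩

variable [DecidableEq κ]

/-- The excess when the central item `h` and the satellites `A` are rounded by `X`: a satellite
`e` counts with `h` for the agent `φ e`, and separately for its other holder. -/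
lemma sum_max_change_le (hx : IsFractional x c) {h : κ} {A : Finset κ} (hA : h ∉ A) {φ : κ → ι}
    (hinj : Set.InjOn φ A) (X : κ → ι)
    (hX : ∀ e ∈ A, X e ≠ φ e → x (X e) e = 1 - x (φ e) e) :
    ∑ i, max (∑ e ∈ insert h A, change x c X i e) 0 ≤
      ∑ i ∈ Finset.univ \ A.image φ, (if X h = i then 1 - x i h else 0) +
      ∑ e ∈ A, (max (change x c X (φ e) h + change x c X (φ e) e) 0 +
        if X e = φ e then 0 else x (φ e) e) := by
  have h1 : ∀ i, ∀ e ∈ A, change x c X i e ≤ (if φ e = i then change x c X i e else 0) +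
      if X e = i then (if X e = φ e then 0 else x (φ e) e) else 0 := by
    intro i e he
    by_cases h1 : φ e = i
    · subst h1
      by_cases h2 : X e = φ e <;> simp [h2]
    · have h3 := change_self_le hx X i e
      by_cases h2 : X e = i
      · have h4 := hX e he (h2.trans_ne (Ne.symm h1))
        rw [h2] at h4
        simp only [h2, if_true, h1, if_false, zero_add, Ne.symm h1] at h3 ⊢
        have := hx.nonneg (φ e) e
        nlinarith [hx.cost_le i e]
      · simpa [h1, h2] using h3
  have h2 : ∀ i, max (∑ e ∈ insert h A, change x c X i e) 0 ≤
      max (change x c X i h + ∑ e ∈ A, if φ e = i then change x c X i e else 0) 0 +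
      ∑ e ∈ A, if X e = i then (if X e = φ e then 0 else x (φ e) e) else 0 := by
    intro i
    have h3 : 0 ≤ ∑ e ∈ A, if X e = i then (if X e = φ e then 0 else x (φ e) e) else 0 := by
      refine Finset.sum_nonneg fun e _ => ?_
      have := hx.nonneg (φ e) e
      split_ifs <;> simp [this]
    refine max_le ?_ (add_nonneg (le_max_right _ _) h3)
    rw [Finset.sum_insert hA]
    have h4 := Finset.sum_le_sum (h1 i)
    rw [Finset.sum_add_distrib] at h4
    have := le_max_left (change x c X i h + ∑ e ∈ A, if φ e = i then change x c X i e else 0) 0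
    linarith
  refine (Finset.sum_le_sum fun i _ => h2 i).trans ?_
  rw [Finset.sum_add_distrib, Finset.sum_comm, Finset.sum_add_distrib, ← add_assoc]
  refine add_le_add ?_ (Finset.sum_le_sum fun e _ => by simp)
  rw [← Finset.sum_sdiff (Finset.subset_univ (A.image φ)), Finset.sum_image hinj]
  refine add_le_add (Finset.sum_le_sum fun i hi => ?_) (Finset.sum_le_sum fun e he => ?_)
  · have h5 : ∀ e ∈ A, (if φ e = i then change x c X i e else 0) = 0 := by
      intro e he
      refine if_neg ?_
      rintro rfl
      exact (Finset.mem_sdiff.1 hi).2 (Finset.mem_image_of_mem φ he)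
    rw [Finset.sum_congr rfl h5, Finset.sum_const_zero, add_zero]
    have h6 := change_self_le hx X i h
    have h7 := x_le_one hx i h
    split_ifs at h6 ⊢ with h8
    · exact max_le (h6.trans (by nlinarith [hx.cost_le i h])) (by linarith)
    · exact max_le h6 le_rfl
  · have h5 : ∑ f ∈ A, (if φ f = φ e then change x c X (φ e) f else 0) =
        change x c X (φ e) e := by
      rw [Finset.sum_eq_single_of_mem e he, if_pos rfl]
      intro f hf hfe
      exact if_neg fun h => hfe (hinj hf he h)
    rw [h5]

/-- The bound for a central item `h`, shared by any number of agents, with satellites `A` that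
have two holders each. -/
lemma roundsWithin_star (hx : IsFractional x c) {h : κ} {A : Finset κ} (hA : h ∉ A) {φ : κ → ι}
    (hinj : Set.InjOn φ A) (hφ : ∀ e ∈ A, 0 < x (φ e) e)
    (hcard : ∀ e ∈ A, (support x e).card = 2) :
    RoundsWithin x c (insert h A)
      (∑ i ∈ Finset.univ \ A.image φ, x i h * (1 - x i h) +
        ∑ e ∈ A, satelliteBound (x (φ e) h) (x (φ e) e) (c (φ e) h) (c (φ e) e)) := by
  have ho : ∀ e, ∃ o, e ∈ A → o ≠ φ e ∧ 0 < x o e ∧ x o e = 1 - x (φ e) e := by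
    intro e
    by_cases he : e ∈ A
    · obtain ⟨o, ho⟩ := exists_other_holder hx (hφ e he) (hcard e he)
      exact ⟨o, fun _ => ho⟩
    · exact ⟨φ e, fun h => absurd h he⟩
  choose o ho using ho
  set G := fun e => gainBound (x (φ e) h) (x (φ e) e) (c (φ e) h) (c (φ e) e) with hG
  set Lo := fun e => lossBound (x (φ e) h) (x (φ e) e) (c (φ e) h) (c (φ e) e) with hLo
  -- The bound on the excess when `h` goes to `g`. It is achieved by giving each satellite to the
  -- holder that realises the minimum in `gainBound` or `lossBound`.
  set U : ι → ℝ := fun g => ∑ i ∈ Finset.univ \ A.image φ, (if g = i then 1 - x i h else 0) +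
      ∑ e ∈ A, (if φ e = g then G e else Lo e) with hU
  have key : ∀ g, 0 < x g h → RoundsWithin x c (insert h A) (U g) := by
    intro g hg
    set a := fun e => x (φ e) h
    set b := fun e => x (φ e) e
    set C := fun e => c (φ e) h
    set D := fun e => c (φ e) e
    let X : κ → ι := fun e => if e = h then g else
      if φ e = g then
        if b e + max ((1 - a e) * C e - b e * D e) 0 ≤ (1 - a e) * C e + (1 - b e) * D e
        then o e else φ e
      else if b e ≤ max ((1 - b e) * D e - a e * C e) 0 then o e else φ e
    have hXh : X h = g := if_pos rfl
    have hXA : ∀ e ∈ A, X e = φ e ∨ X e = o e := by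
      intro e he
      have : e ≠ h := fun h' => hA (h' ▸ he)
      simp only [X, this, if_false]
      split_ifs <;> simp
    refine ⟨X, ?_, ?_⟩
    · intro e he
      rcases Finset.mem_insert.1 he with rfl | he
      · rw [hXh]; exact hg
      · rcases hXA e he with h' | h'
        · rw [h']; exact hφ e he
        · rw [h']; exact (ho e he).2.1
    · refine (sum_max_change_le hx hA hinj X ?_).trans ?_
      · intro e he hne
        rw [(hXA e he).resolve_left hne]
        exact (ho e he).2.2
      · rw [hU, hXh]
        refine add_le_add le_rfl (Finset.sum_le_sum fun e he => ?_)
        have heh : e ≠ h := fun h' => hA (h' ▸ he)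
        have hoe := (ho e he).1
        have hCh : change x c X (φ e) h = ((if φ e = g then 1 else 0) - a e) * C e := by
          simp only [change, hXh, a, C, eq_comm]
        by_cases hg' : φ e = g
        · rw [if_pos hg', hCh, if_pos hg']
          have hXe : X e = if b e + max ((1 - a e) * C e - b e * D e) 0 ≤
              (1 - a e) * C e + (1 - b e) * D e then o e else φ e := by
            simp only [X, heh, if_false, hg', if_true]
          simp only [hG, gainBound, change]
          split_ifs at hXe with h1
          · rw [hXe, min_eq_left h1, if_neg hoe, if_neg hoe, add_comm]
            refine le_of_eq ?_
            simp only [a, b, C, D]; ring_nf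
          · rw [hXe, min_eq_right (not_le.1 h1).le, if_pos rfl, if_pos rfl, add_zero]
            refine max_le le_rfl ?_
            have := x_le_one hx (φ e) e
            have := x_le_one hx (φ e) h
            have := hx.cost_nonneg (φ e) e
            have := hx.cost_nonneg (φ e) h
            exact add_nonneg (mul_nonneg (by linarith) (by assumption))
              (mul_nonneg (by linarith) (by assumption))
        · rw [if_neg hg', hCh, if_neg hg']
          have hXe : X e = if b e ≤ max ((1 - b e) * D e - a e * C e) 0
              then o e else φ e := by
            simp only [X, heh, if_false, hg']
          simp only [hLo, lossBound, change]
          have hn1 := mul_nonneg (hx.nonneg (φ e) e) (hx.cost_nonneg (φ e) e)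
          have hn2 := mul_nonneg (hx.nonneg (φ e) h) (hx.cost_nonneg (φ e) h)
          split_ifs at hXe with h1
          · rw [hXe, min_eq_left h1, if_neg hoe, if_neg hoe, max_eq_right]
            · simp [b]
            · simp only [a, C]; linarith
          · rw [hXe, min_eq_right (not_le.1 h1).le, if_pos rfl, if_pos rfl, add_zero]
            refine le_of_eq ?_
            simp only [a, b, C, D]; ring_nf
  have hsum : ∑ g, x g h * U g = ∑ i ∈ Finset.univ \ A.image φ, x i h * (1 - x i h) +
        ∑ e ∈ A, satelliteBound (x (φ e) h) (x (φ e) e) (c (φ e) h) (c (φ e) e) := by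
    simp only [hU, mul_add, Finset.mul_sum, Finset.sum_add_distrib]
    rw [Finset.sum_comm, Finset.sum_comm (s := Finset.univ) (t := A)]
    congr 1
    · refine Finset.sum_congr rfl fun i _ => ?_
      simp
    · refine Finset.sum_congr rfl fun e _ => ?_
      have : ∀ g, x g h * (if φ e = g then G e else Lo e) =
          x g h * Lo e + if φ e = g then x g h * (G e - Lo e) else 0 := by
        intro g; split_ifs <;> ring
      simp only [this, Finset.sum_add_distrib, ← Finset.sum_mul, hx.sum_eq,
        Finset.sum_ite_eq, Finset.mem_univ, if_true]
      simp only [satelliteBound, hG, hLo]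
      ring
  rw [← hsum]
  -- Averaging: the weights `x g h` sum to one, so not every `g` of positive weight can have `U g`
  -- above the mean.
  by_contra hcon
  have hlt : ∀ g, 0 < x g h → ∑ g, x g h * U g < U g := by
    intro g hg
    by_contra hle
    exact hcon ((key g hg).mono (not_lt.1 hle))
  obtain ⟨g₀, hg₀⟩ := exists_pos hx h
  have hl : ∑ g, x g h * (∑ g, x g h * U g) < ∑ g, x g h * U g := by
    refine Finset.sum_lt_sum (fun g _ => ?_)
      ⟨g₀, Finset.mem_univ _, mul_lt_mul_of_pos_left (hlt g₀ hg₀) hg₀⟩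
    rcases (hx.nonneg g h).eq_or_lt with h0 | h0
    · simp [← h0]
    · exact (mul_lt_mul_of_pos_left (hlt g h0) h0).le
  rw [← Finset.sum_mul, hx.sum_eq, one_mul] at hl
  exact lt_irrefl _ hl

end Rounding

/-! ### Budgets for single items, pairs and large stars. -/

namespace Rounding

variable {ι κ : Type*} [Fintype ι] {x c : ι → κ → ℝ}

/-- With S the sum of the fractions and k the cardinality, Cauchy–Schwarz bounds the sum by S -
S²/k. This increases for S ≤ 1, because k ≥ 2, and so is at most 1 - 1/k. -/
lemma card_mul_sum_le (hx : IsFractional x c) (h : κ) {s : Finset ι} (hs : 2 ≤ s.card) :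
    s.card * ∑ i ∈ s, x i h * (1 - x i h) ≤ s.card - 1 := by
  have h1 : ∑ i ∈ s, x i h ≤ 1 := by
    rw [← hx.sum_eq h]
    exact Finset.sum_le_sum_of_subset_of_nonneg (Finset.subset_univ _) fun i _ _ => hx.nonneg i h
  have h0 : 0 ≤ ∑ i ∈ s, x i h := Finset.sum_nonneg fun i _ => hx.nonneg i h
  have h2 := sq_sum_le_card_mul_sum_sq (s := s) (f := fun i => x i h)
  have h3 : ∑ i ∈ s, x i h * (1 - x i h) = ∑ i ∈ s, x i h - ∑ i ∈ s, x i h ^ 2 := by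
    rw [← Finset.sum_sub_distrib]
    exact Finset.sum_congr rfl fun i _ => by ring
  have h4 : (2 : ℝ) ≤ s.card := by exact_mod_cast hs
  rw [h3]
  nlinarith

variable [DecidableEq ι]

lemma sum_sdiff_eq (hx : IsFractional x c) (h : κ) (T : Finset ι) :
    ∑ i ∈ Finset.univ \ T, x i h * (1 - x i h) =
      ∑ i ∈ support x h \ T, x i h * (1 - x i h) := by
  symm
  refine Finset.sum_subset (Finset.sdiff_subset_sdiff (Finset.subset_univ _) subset_rfl) ?_
  intro i hi hi'
  have : ¬ 0 < x i h := fun h0 =>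
    hi' (Finset.mem_sdiff.2 ⟨mem_support.2 h0, (Finset.mem_sdiff.1 hi).2⟩)
  rw [le_antisymm (not_lt.1 this) (hx.nonneg i h), zero_mul]

variable [DecidableEq κ]

lemma roundsWithin_singleton (hx : IsFractional x c) {e : κ} (he : (support x e).card = 2) :
    RoundsWithin x c {e} (1 / 2) := by
  have h1 := roundsWithin_star hx (h := e) (A := ∅) (φ := fun _ => (exists_pos hx e).choose)
    (Finset.notMem_empty e) (by simp) (by simp) (by simp)
  rw [insert_empty_eq] at h1
  refine h1.mono ?_
  rw [sum_sdiff_eq hx, Finset.image_empty, Finset.sdiff_empty, Finset.sum_empty, add_zero]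
  have h2 := card_mul_sum_le hx e he.ge
  rw [he] at h2
  push_cast at h2
  linarith

lemma roundsWithin_pair (hx : IsFractional x c) {e f : κ} (hef : e ≠ f)
    (he : (support x e).card = 2) (hf : (support x f).card = 2) {i : ι} (hie : 0 < x i e)
    (hif : 0 < x i f) : RoundsWithin x c {e, f} (2 / 3) := by
  wlog hc : c i f ≤ c i e generalizing e f
  · rw [Finset.pair_comm]
    exact this hef.symm hf he hif hie (not_le.1 hc).le
  have h1 := roundsWithin_star hx (h := e) (A := {f}) (φ := fun _ => i)
    (by simpa using hef) (by simp) (by simpa using hif) (by simpa using hf)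
  refine h1.mono ?_
  rw [sum_sdiff_eq hx, Finset.image_singleton, Finset.sum_singleton, Finset.sdiff_singleton_eq_erase]
  obtain ⟨o, hoi, ho, hoe⟩ := exists_other_holder hx hie he
  have h2 : (support x e).erase i = {o} := by
    symm
    refine Finset.eq_of_subset_of_card_le ?_ ?_
    · simpa [hoi] using mem_support.2 ho
    · rw [Finset.card_erase_of_mem (mem_support.2 hie), he, Finset.card_singleton]
  rw [h2, Finset.sum_singleton, hoe]
  have := satelliteBound_add_le (hx.nonneg i e) (x_le_one hx i e) (hx.nonneg i f) (x_le_one hx i f)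
    (hx.cost_le i e) (hx.cost_nonneg i f) hc
  linarith

/-- Let u be the number of holders of `h` without satellite. Each satellite costs at most 1/2 and,
together with its agent's place at `h`, contributes 2/3 to the budget. The surplus pays for u = 0,
1, 2, where at least 3, 2, 1 satellites are present; for u ≥ 3, already 1 - 1/u ≤ (u-1)/3. -/
lemma roundsWithin_bigStar (hx : IsFractional x c) {h : κ} {A : Finset κ} (hA : h ∉ A)
    {φ : κ → ι} (hinj : Set.InjOn φ A) (hφ : ∀ e ∈ A, 0 < x (φ e) e)
    (hφh : ∀ e ∈ A, 0 < x (φ e) h) (hcard : ∀ e ∈ A, (support x e).card = 2)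
    (hh : 3 ≤ (support x h).card) :
    RoundsWithin x c (insert h A) (((support x h).card - 1 + A.card) / 3) := by
  refine (roundsWithin_star hx hA hinj hφ hcard).mono ?_
  have h1 : ∑ e ∈ A, satelliteBound (x (φ e) h) (x (φ e) e) (c (φ e) h) (c (φ e) e) ≤
      A.card * (1 / 2) := by
    rw [← nsmul_eq_mul]
    exact Finset.sum_le_card_nsmul _ _ _ fun e _ => satelliteBound_le_half (hx.nonneg _ _)
      (x_le_one hx _ _) (hx.nonneg _ _) (x_le_one hx _ _) (hx.cost_le _ _) (hx.cost_nonneg _ _)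
      (hx.cost_le _ _)
  rw [sum_sdiff_eq hx]
  have hsub : A.image φ ⊆ support x h := by
    intro i hi
    obtain ⟨e, he, rfl⟩ := Finset.mem_image.1 hi
    exact mem_support.2 (hφh e he)
  have hk : (support x h \ A.image φ).card + A.card = (support x h).card := by
    rw [← Finset.card_image_of_injOn hinj]
    exact Finset.card_sdiff_add_card_eq_card hsub
  have hkR : ((support x h).card : ℝ) = (support x h \ A.image φ).card + A.card := by
    exact_mod_cast hk.symm
  have h3 := fun hu => card_mul_sum_le hx h (s := support x h \ A.image φ) hu
  have h4 : (support x h \ A.image φ).card = 1 →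
      ∑ i ∈ support x h \ A.image φ, x i h * (1 - x i h) ≤ 1 / 4 := by
    intro h5
    obtain ⟨o, ho⟩ := Finset.card_eq_one.1 h5
    rw [ho, Finset.sum_singleton]
    nlinarith [sq_nonneg (x o h - 1 / 2)]
  have h5 : (support x h \ A.image φ).card = 0 →
      ∑ i ∈ support x h \ A.image φ, x i h * (1 - x i h) = 0 := by
    intro h5
    rw [Finset.card_eq_zero.1 h5, Finset.sum_empty]
  have h6 : (0 : ℝ) ≤ A.card := Nat.cast_nonneg _
  rw [hkR]
  generalize ∑ i ∈ support x h \ A.image φ, x i h * (1 - x i h) = s at *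
  generalize (support x h \ A.image φ).card = u at *
  rcases Nat.lt_or_ge u 3 with hu | hu
  · interval_cases u
    · have : (3 : ℝ) ≤ A.card := by exact_mod_cast (by omega : 3 ≤ A.card)
      have := h5 rfl
      push_cast
      linarith
    · have : (2 : ℝ) ≤ A.card := by exact_mod_cast (by omega : 2 ≤ A.card)
      have := h4 rfl
      push_cast
      linarith
    · have : (1 : ℝ) ≤ A.card := by exact_mod_cast (by omega : 1 ≤ A.card)
      have := h3 le_rfl
      push_cast at this ⊢
      linarith
  · have h7 := h3 (by omega)
    have h8 : (3 : ℝ) ≤ u := by exact_mod_cast hu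
    have h9 : s ≤ (u - 1) / 3 := by
      have : (u : ℝ) * s ≤ u * ((u - 1) / 3) := by nlinarith
      exact le_of_mul_le_mul_left this (by linarith)
    linarith

/-- The items assigned to the same agent can be rounded in pairs; one item per agent remains, if
the number of items assigned to her is odd. -/
lemma exists_remainder (hx : IsFractional x c) (φ : κ → ι) (S : Finset κ)
    (hφ : ∀ e ∈ S, 0 < x (φ e) e) (hS : ∀ e ∈ S, (support x e).card = 2) :
    ∃ R ⊆ S, Set.InjOn φ R ∧ (∀ e ∈ R, Odd ({f ∈ S | φ f = φ e} : Finset κ).card) ∧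
      RoundsWithin x c (S \ R) (((S.card : ℝ) - R.card) / 3) := by
  induction S using Finset.strongInduction with
  | H S ih =>
    by_cases hinj : Set.InjOn φ S
    · refine ⟨S, subset_rfl, hinj, fun e he => ?_, ?_⟩
      · have : ({f ∈ S | φ f = φ e} : Finset κ) = {e} := by
          ext f
          simp only [Finset.mem_filter, Finset.mem_singleton]
          exact ⟨fun h => hinj h.1 he h.2, by rintro rfl; exact ⟨he, rfl⟩⟩
        rw [this, Finset.card_singleton]
        exact odd_one
      · simpa using roundsWithin_empty hx
    · simp only [Set.InjOn, not_forall, Finset.mem_coe] at hinj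
      obtain ⟨e, he, f, hf, hef, hne⟩ := hinj
      have hsub : ({e, f} : Finset κ) ⊆ S := by
        intro g hg
        rcases Finset.mem_insert.1 hg with rfl | hg
        · exact he
        · rwa [Finset.mem_singleton.1 hg]
      have hss : S \ {e, f} ⊂ S := Finset.sdiff_ssubset hsub ⟨e, by simp⟩
      obtain ⟨R, hRS, h1, h2, h3⟩ := ih (S \ {e, f}) hss (fun g hg => hφ g (hss.1 hg))
        (fun g hg => hS g (hss.1 hg))
      have hcard : (S \ {e, f}).card + 2 = S.card := by
        rw [← Finset.card_pair hne]
        exact Finset.card_sdiff_add_card_eq_card hsub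
      -- Putting back two items of the same agent preserves all parities, and rounding them as a
      -- pair costs the 2/3 they are allowed.
      refine ⟨R, hRS.trans hss.1, h1, fun g hg => ?_, ?_⟩
      · have h4 := h2 g hg
        by_cases hg' : φ e = φ g
        · have h5 : ({k ∈ S | φ k = φ g} : Finset κ) =
              ({k ∈ S \ {e, f} | φ k = φ g} : Finset κ) ∪ {e, f} := by
            ext k
            simp only [Finset.mem_filter, Finset.mem_union, Finset.mem_sdiff, Finset.mem_insert,
              Finset.mem_singleton]
            constructor
            · rintro ⟨hk, hk'⟩
              by_cases h : k = e ∨ k = f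
              · exact Or.inr h
              · exact Or.inl ⟨⟨hk, h⟩, hk'⟩
            · rintro (⟨⟨hk, -⟩, hk'⟩ | rfl | rfl)
              · exact ⟨hk, hk'⟩
              · exact ⟨he, hg'⟩
              · exact ⟨hf, hef.symm.trans hg'⟩
          rw [h5, Finset.card_union_of_disjoint, Finset.card_pair hne]
          · exact h4.add_even even_two
          · rw [Finset.disjoint_left]
            intro k hk
            exact (Finset.mem_sdiff.1 (Finset.mem_filter.1 hk).1).2
        · have h5 : ({k ∈ S | φ k = φ g} : Finset κ) =
              ({k ∈ S \ {e, f} | φ k = φ g} : Finset κ) := by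
            ext k
            simp only [Finset.mem_filter, Finset.mem_sdiff, Finset.mem_insert,
              Finset.mem_singleton]
            constructor
            · rintro ⟨hk, hk'⟩
              refine ⟨⟨hk, ?_⟩, hk'⟩
              rintro (rfl | rfl)
              · exact hg' hk'
              · exact hg' (hef.trans hk')
            · rintro ⟨⟨hk, -⟩, hk'⟩
              exact ⟨hk, hk'⟩
          rwa [h5]
      · have hR : ∀ g ∈ R, g ∉ ({e, f} : Finset κ) := fun g hg =>
          (Finset.mem_sdiff.1 (hRS hg)).2
        have h5 : S \ R = (S \ {e, f}) \ R ∪ {e, f} := by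
          ext k
          simp only [Finset.mem_union, Finset.mem_sdiff]
          constructor
          · rintro ⟨hk, hk'⟩
            by_cases h : k ∈ ({e, f} : Finset κ)
            · exact Or.inr h
            · exact Or.inl ⟨⟨hk, h⟩, hk'⟩
          · rintro (⟨⟨hk, -⟩, hk'⟩ | hk)
            · exact ⟨hk, hk'⟩
            · exact ⟨hsub hk, fun h => hR k h hk⟩
        rw [h5]
        refine (h3.union (roundsWithin_pair hx hne (hS e he) (hS f hf) (hφ e he)
          (hef ▸ hφ f hf)) ?_).mono ?_
        · rw [Finset.disjoint_left]
          intro k hk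
          exact (Finset.mem_sdiff.1 (Finset.mem_sdiff.1 hk).1).2
        · have : (S.card : ℝ) = (S \ {e, f}).card + 2 := by exact_mod_cast hcard.symm
          rw [this]
          linarith

/-! ### Parities of assignments of two-holder items. -/

/-- Two agents who share an item in `S`. -/
def Linked (x : ι → κ → ℝ) (S : Finset κ) (v w : ι) : Prop := ∃ e ∈ S, 0 < x v e ∧ 0 < x w e

/-- The parity of the number of items in `S` that are assigned to `v`. -/
def parity (S : Finset κ) (φ : κ → ι) (v : ι) : ZMod 2 := ∑ e ∈ S, if φ e = v then 1 else 0

omit [Fintype ι] [DecidableEq κ] in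
lemma parity_ne_zero {S : Finset κ} {φ : κ → ι} {v : ι} :
    parity S φ v ≠ 0 ↔ Odd ({e ∈ S | φ e = v} : Finset κ).card := by
  rw [parity, Finset.sum_boole, ZMod.natCast_ne_zero_iff_odd]

omit [Fintype ι] in
lemma parity_update {S : Finset κ} {φ : κ → ι} {e : κ} (he : e ∈ S) (w u : ι) :
    parity S (Function.update φ e w) u =
      parity S φ u + (if φ e = u then 1 else 0) + if w = u then 1 else 0 := by
  rw [parity, parity, ← Finset.add_sum_erase _ _ he,
    ← Finset.add_sum_erase S (fun e => if φ e = u then (1 : ZMod 2) else 0) he]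
  have : ∑ f ∈ S.erase e, (if Function.update φ e w f = u then (1 : ZMod 2) else 0) =
      ∑ f ∈ S.erase e, if φ f = u then 1 else 0 :=
    Finset.sum_congr rfl fun f hf => by rw [Function.update_of_ne (Finset.ne_of_mem_erase hf)]
  rw [this, Function.update_self]
  have h2 := CharTwo.add_self_eq_zero (if φ e = u then (1 : ZMod 2) else 0)
  linear_combination -h2

/-- Moving the common item to its other holder toggles the parities of both holders. For v = w the
two toggles cancel. -/
lemma exists_flip {S : Finset κ} (hS : ∀ e ∈ S, (support x e).card = 2) {φ : κ → ι}
    (hφ : ∀ e ∈ S, 0 < x (φ e) e) {v w : ι} (h : Linked x S v w) :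
    ∃ ψ : κ → ι, (∀ e ∈ S, 0 < x (ψ e) e) ∧
      ∀ u, parity S ψ u = parity S φ u + (if v = u then 1 else 0) + if w = u then 1 else 0 := by
  obtain ⟨e, he, hv, hw⟩ := h
  have hval : ∀ u, 0 < x u e → ∀ f ∈ S, 0 < x (Function.update φ e u f) f := by
    intro u hu f hf
    by_cases hfe : f = e
    · subst hfe; simpa using hu
    · rw [Function.update_of_ne hfe]; exact hφ f hf
  by_cases h1 : φ e = v
  · exact ⟨_, hval w hw, fun u => by rw [parity_update he, h1]⟩
  by_cases h2 : φ e = w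
  · exact ⟨_, hval v hv, fun u => by rw [parity_update he, h2, add_right_comm]⟩
  have h3 : v = w := by
    by_contra h3
    have h4 : ({φ e, v, w} : Finset ι) ⊆ support x e := by
      intro i hi
      simp only [Finset.mem_insert, Finset.mem_singleton] at hi
      rcases hi with rfl | rfl | rfl
      · exact mem_support.2 (hφ e he)
      · exact mem_support.2 hv
      · exact mem_support.2 hw
    have h5 := Finset.card_le_card h4
    rw [hS e he, Finset.card_eq_three.2 ⟨φ e, v, w, h1, h2, h3, rfl⟩] at h5
    omega
  refine ⟨φ, hφ, fun u => ?_⟩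
  rw [h3, add_assoc, CharTwo.add_self_eq_zero, add_zero]

/-- Flipping along the path toggles inner agents twice, which leaves only the end points changed. -/
lemma exists_flip_path {S : Finset κ} (hS : ∀ e ∈ S, (support x e).card = 2) {φ : κ → ι}
    (hφ : ∀ e ∈ S, 0 < x (φ e) e) {v w : ι} (h : Relation.ReflTransGen (Linked x S) v w) :
    ∃ ψ : κ → ι, (∀ e ∈ S, 0 < x (ψ e) e) ∧
      ∀ u, parity S ψ u = parity S φ u + (if v = u then 1 else 0) + if w = u then 1 else 0 := by
  induction h with
  | refl =>
    exact ⟨φ, hφ, fun u => by rw [add_assoc, CharTwo.add_self_eq_zero, add_zero]⟩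
  | @tail b d _ hbc ih =>
    obtain ⟨ψ, h1, h2⟩ := ih
    obtain ⟨χ, h3, h4⟩ := exists_flip hS h1 hbc
    refine ⟨χ, h3, fun u => ?_⟩
    rw [h4, h2]
    linear_combination CharTwo.add_self_eq_zero (if b = u then (1 : ZMod 2) else 0)

/-- An assignment of the items in `S` to their holders in which as few as possible of the agents
outside `Z` have an odd number of items. -/
lemma exists_assignment (hx : IsFractional x c) {S : Finset κ}
    (hS : ∀ e ∈ S, (support x e).card = 2) (Z : ι → Prop) :
    ∃ (φ : κ → ι) (B : Finset ι), (∀ e ∈ S, 0 < x (φ e) e) ∧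
      (∀ v, v ∈ B ↔ ¬ Z v ∧ parity S φ v ≠ 0) ∧
      ∀ v ∈ B, ∀ w, Relation.ReflTransGen (Linked x S) v w → ¬ Z w ∧ (w ∈ B → w = v) := by
  classical
  let B : (κ → ι) → Finset ι := fun φ => {v | ¬ Z v ∧ parity S φ v ≠ 0}
  have hB : ∀ φ v, v ∈ B φ ↔ ¬ Z v ∧ parity S φ v ≠ 0 := by simp [B]
  obtain ⟨φ, hφ, hmin⟩ : ∃ φ : κ → ι, (∀ e ∈ S, 0 < x (φ e) e) ∧
      ∀ ψ : κ → ι, (∀ e ∈ S, 0 < x (ψ e) e) → (B φ).card ≤ (B ψ).card := by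
    obtain ⟨φ, hφ, hmin⟩ := WellFounded.has_min
      (InvImage.wf (fun φ : κ → ι => (B φ).card) Nat.lt_wfRel.wf)
      {φ | ∀ e ∈ S, 0 < x (φ e) e} ⟨fun e => (exists_pos hx e).choose,
        fun e _ => (exists_pos hx e).choose_spec⟩
    exact ⟨φ, hφ, fun ψ hψ => not_lt.1 (hmin ψ hψ)⟩
  refine ⟨φ, B φ, hφ, hB φ, fun v hv w hvw => ?_⟩
  by_contra hcon
  have hwv : w ≠ v ∧ (Z w ∨ w ∈ B φ) := by
    by_cases hZ : Z w
    · refine ⟨?_, Or.inl hZ⟩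
      rintro rfl
      exact ((hB φ w).1 hv).1 hZ
    · simp only [hZ, not_false_eq_true, true_and, Classical.not_imp] at hcon
      exact ⟨hcon.2, Or.inr hcon.1⟩
  -- The flip takes `v` out of `B` and adds nobody: `w` satisfies `Z` or was in `B` already. This
  -- contradicts minimality.
  obtain ⟨ψ, hψ, hpar⟩ := exists_flip_path hS hφ hvw
  refine absurd (hmin ψ hψ) (not_le.2 (Finset.card_lt_card ?_))
  have hone : ∀ a : ZMod 2, a ≠ 0 → a + 1 = 0 := by decide
  refine Finset.ssubset_iff_of_subset (fun u hu => ?_) |>.2 ⟨v, hv, fun hv' => ?_⟩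
  · rw [hB] at hu ⊢
    refine ⟨hu.1, ?_⟩
    have h1 := hu.2
    rw [hpar] at h1
    by_cases huw : w = u
    · subst huw
      rcases hwv.2 with h | h
      · exact absurd h hu.1
      · exact ((hB φ w).1 h).2
    · by_cases huv : v = u
      · subst huv; exact ((hB φ v).1 hv).2
      · simpa [huw, huv] using h1
  · have h1 := ((hB ψ v).1 hv').2
    rw [hpar, if_pos rfl, if_neg hwv.1, add_zero] at h1
    exact h1 (hone _ ((hB φ v).1 hv).2)

/-! ### The general rounding bound. -/

/-- The items in `F` that have exactly two holders. -/
def twoItems (x : ι → κ → ℝ) (F : Finset κ) : Finset κ := {e ∈ F | (support x e).card = 2}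

/-- Every group of items stays within 1/3 per edge, except the items left over at agents of `B`,
which are rounded alone at 1/2 = 1/3 + 1/6. The second conclusion isolates the agents of `B`, so
that they can be counted or excluded by connectivity. -/
theorem exists_roundsWithin (hx : IsFractional x c) (F : Finset κ)
    (hF : ∀ e ∈ F, 2 ≤ (support x e).card) :
    ∃ B : Finset ι,
      RoundsWithin x c F ((∑ e ∈ F, ((support x e).card - 1 : ℝ)) / 3 + B.card / 6) ∧
      ∀ v ∈ B, (∃ e ∈ F, 0 < x v e) ∧
        ∀ w, Relation.ReflTransGen (Linked x (twoItems x F)) v w →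
          (∀ e ∈ F, 0 < x w e → (support x e).card = 2) ∧ (w ∈ B → w = v) := by
  classical
  set S := twoItems x F with hSdef
  set D : Finset κ := {e ∈ F | ¬ (support x e).card = 2} with hDdef
  have hmemS : ∀ e, e ∈ S ↔ e ∈ F ∧ (support x e).card = 2 := by simp [hSdef, twoItems]
  have hmemD : ∀ e, e ∈ D ↔ e ∈ F ∧ ¬ (support x e).card = 2 := by simp [hDdef]
  have hS : ∀ e ∈ S, (support x e).card = 2 := fun e he => ((hmemS e).1 he).2
  have hD : ∀ e ∈ D, 3 ≤ (support x e).card := by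
    intro e he
    have h1 := (hmemD e).1 he
    have := hF e h1.1
    omega
  obtain ⟨φ, B, hφ, hB, hconn⟩ := exists_assignment hx hS (fun v => ∃ e ∈ D, 0 < x v e)
  obtain ⟨R, hRS, hinj, hodd, hround⟩ := exists_remainder hx φ S hφ hS
  refine ⟨B, ?_, fun v hv => ⟨?_, fun w hw => ⟨fun e he hwe => ?_, (hconn v hv w hw).2⟩⟩⟩
  swap
  · have h1 := parity_ne_zero.1 ((hB v).1 hv).2
    obtain ⟨e, he⟩ := Finset.card_pos.1 h1.pos
    rw [Finset.mem_filter] at he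
    exact ⟨e, ((hmemS e).1 he.1).1, he.2 ▸ hφ e he.1⟩
  swap
  · by_contra h2
    exact (hconn v hv w hw).1 ⟨e, (hmemD e).2 ⟨he, h2⟩, hwe⟩
  set RB : Finset κ := {e ∈ R | φ e ∈ B} with hRB
  set RZ : Finset κ := {e ∈ R | ¬ φ e ∈ B} with hRZ
  have hRBR : RB ⊆ R := Finset.filter_subset _ _
  have hRZR : RZ ⊆ R := Finset.filter_subset _ _
  -- An agent of odd parity outside `B` holds some item with at least three holders; it serves as
  -- the centre `g e` for her leftover item.
  have hg : ∀ e, ∃ h, e ∈ RZ → h ∈ D ∧ 0 < x (φ e) h := by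
    intro e
    by_cases he : e ∈ RZ
    · have h1 := Finset.mem_filter.1 he
      have h2 := parity_ne_zero.2 (hodd e h1.1)
      have h3 : ∃ h ∈ D, 0 < x (φ e) h := by
        by_contra h3
        exact h1.2 ((hB _).2 ⟨h3, h2⟩)
      obtain ⟨h, h4⟩ := h3
      exact ⟨h, fun _ => h4⟩
    · exact ⟨e, fun h => absurd h he⟩
  choose g hg using hg
  have hRD : ∀ e ∈ R, e ∉ D := fun e he hD' =>
    ((hmemD e).1 hD').2 (hS e (hRS he))
  have hb : RoundsWithin x c (RB.biUnion fun e => {e}) (∑ e ∈ RB, (1 / 2 : ℝ)) := by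
    refine roundsWithin_biUnion hx RB _ _
      (fun e he => roundsWithin_singleton hx (hS e (hRS (hRBR he)))) ?_
    intro e _ f _ hef
    simpa using hef
  have hz : RoundsWithin x c (D.biUnion fun h => insert h {e ∈ RZ | g e = h})
      (∑ h ∈ D, (((support x h).card - 1 + ({e ∈ RZ | g e = h} : Finset κ).card : ℝ) / 3)) := by
    refine roundsWithin_biUnion hx D _ _ (fun h hh => ?_) ?_
    · have hsub : ({e ∈ RZ | g e = h} : Finset κ) ⊆ RZ := Finset.filter_subset _ _
      refine roundsWithin_bigStar hx (φ := φ) ?_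
        (hinj.mono (Finset.coe_subset.2 (hsub.trans hRZR)))
        (fun e he => hφ e (hRS (hRZR (hsub he)))) (fun e he => ?_)
        (fun e he => hS e (hRS (hRZR (hsub he)))) (hD h hh)
      · exact fun h' => hRD h (hRZR (hsub h')) hh
      · rw [← (Finset.mem_filter.1 he).2]
        exact (hg e (hsub he)).2
    · intro h hh k hk hhk
      rw [Function.onFun, Finset.disjoint_left]
      intro e he he'
      simp only [Finset.mem_insert, Finset.mem_filter] at he he'
      rcases he with rfl | ⟨he, heh⟩
      · rcases he' with he' | ⟨he', -⟩
        · exact hhk he'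
        · exact hRD e (hRZR he') hh
      · rcases he' with rfl | ⟨-, hek⟩
        · exact hRD e (hRZR he) hk
        · exact hhk (heh.symm.trans hek)
  have hbU : (RB.biUnion fun e => {e}) = RB := Finset.biUnion_singleton_eq_self
  have hzU : (D.biUnion fun h => insert h {e ∈ RZ | g e = h}) = D ∪ RZ := by
    ext e
    simp only [Finset.mem_biUnion, Finset.mem_insert, Finset.mem_filter, Finset.mem_union]
    constructor
    · rintro ⟨h, hh, rfl | ⟨he, -⟩⟩
      · exact Or.inl hh
      · exact Or.inr he
    · rintro (he | he)
      · exact ⟨e, he, Or.inl rfl⟩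
      · exact ⟨g e, (hg e he).1, Or.inr ⟨he, rfl⟩⟩
  rw [hbU] at hb
  rw [hzU] at hz
  have hd1 : Disjoint (S \ R) RB := by
    rw [Finset.disjoint_left]
    exact fun e he he' => (Finset.mem_sdiff.1 he).2 (hRBR he')
  have hd2 : Disjoint (S \ R ∪ RB) (D ∪ RZ) := by
    rw [Finset.disjoint_left]
    intro e he he'
    rcases Finset.mem_union.1 he' with he' | he'
    · have : e ∈ S := by
        rcases Finset.mem_union.1 he with he | he
        · exact (Finset.mem_sdiff.1 he).1
        · exact hRS (hRBR he)
      exact ((hmemD e).1 he').2 (hS e this)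
    · rcases Finset.mem_union.1 he with he | he
      · exact (Finset.mem_sdiff.1 he).2 (hRZR he')
      · exact (Finset.mem_filter.1 he').2 (Finset.mem_filter.1 he).2
  have hU : S \ R ∪ RB ∪ (D ∪ RZ) = F := by
    ext e
    simp only [Finset.mem_union, Finset.mem_sdiff]
    constructor
    · rintro ((h | h) | (h | h))
      · exact ((hmemS e).1 h.1).1
      · exact ((hmemS e).1 (hRS (hRBR h))).1
      · exact ((hmemD e).1 h).1
      · exact ((hmemS e).1 (hRS (hRZR h))).1
    · intro he
      by_cases h2 : (support x e).card = 2
      · by_cases hR : e ∈ R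
        · by_cases heB : φ e ∈ B
          · exact Or.inl (Or.inr (Finset.mem_filter.2 ⟨hR, heB⟩))
          · exact Or.inr (Or.inr (Finset.mem_filter.2 ⟨hR, heB⟩))
        · exact Or.inl (Or.inl ⟨(hmemS e).2 ⟨he, h2⟩, hR⟩)
      · exact Or.inr (Or.inl ((hmemD e).2 ⟨he, h2⟩))
  have hall := (hround.union hb hd1).union hz hd2
  rw [hU] at hall
  refine hall.mono ?_
  -- At most one leftover item per agent, as `φ` is injective on `R`.
  have hcardB : (RB.card : ℝ) ≤ B.card := by
    rw [← Finset.card_image_of_injOn (hinj.mono (Finset.coe_subset.2 hRBR))]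
    refine Nat.cast_le.2 (Finset.card_le_card fun i hi => ?_)
    obtain ⟨e, he, rfl⟩ := Finset.mem_image.1 hi
    exact (Finset.mem_filter.1 he).2
  have hcardR : (R.card : ℝ) = RB.card + RZ.card := by
    exact_mod_cast (Finset.card_filter_add_card_filter_not (s := R) (fun e => φ e ∈ B)).symm
  have hcardZ : ∑ h ∈ D, (({e ∈ RZ | g e = h} : Finset κ).card : ℝ) = RZ.card := by
    exact_mod_cast (Finset.card_eq_sum_card_fiberwise (f := g) (s := RZ) (t := D)
      (fun e he => (hg e he).1)).symm
  have hsumF : ∑ e ∈ F, ((support x e).card - 1 : ℝ) =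
      S.card + ∑ e ∈ D, ((support x e).card - 1 : ℝ) := by
    rw [← Finset.sum_filter_add_sum_filter_not F (fun e => (support x e).card = 2)]
    congr 1
    rw [Finset.sum_congr rfl fun e he => show ((support x e).card - 1 : ℝ) = 1 by
      rw [(Finset.mem_filter.1 he).2]; norm_num]
    simp [hSdef, twoItems]
  rw [hsumF, Finset.sum_const, nsmul_eq_mul, ← Finset.sum_div, Finset.sum_add_distrib, hcardZ]
  linarith

end Rounding

/-! ### Components of two-holder items and larger items. -/

namespace Rounding

variable {ι κ : Type*} [Fintype ι] {x : ι → κ → ℝ}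

omit [Fintype ι] in
lemma Linked.symm {S : Finset κ} {v w : ι} (h : Linked x S v w) : Linked x S w v := by
  obtain ⟨e, he, h1, h2⟩ := h
  exact ⟨e, he, h2, h1⟩

omit [Fintype ι] in
lemma reflTransGen_linked_symm {S : Finset κ} {v w : ι}
    (h : Relation.ReflTransGen (Linked x S) v w) : Relation.ReflTransGen (Linked x S) w v := by
  induction h with
  | refl => exact .refl
  | tail _ h ih => exact .head h.symm ih

/-- Along a walk from a holder of `h` to `v`, the last agent reached through a larger item, or `u`
itself if there is none, is joined to `v` by two-holder items only. -/
lemma exists_linked_big {F : Finset κ} {u v : ι} {h : κ} (hF : h ∈ F) (hu : 0 < x u h)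
    (hh : (support x h).card ≠ 2) (huv : Relation.ReflTransGen (Linked x F) u v) :
    ∃ w, (∃ e ∈ F, 0 < x w e ∧ (support x e).card ≠ 2) ∧
      Relation.ReflTransGen (Linked x (twoItems x F)) v w := by
  induction huv with
  | refl => exact ⟨u, ⟨h, hF, hu, hh⟩, .refl⟩
  | @tail b d _ hbd ih =>
    obtain ⟨e, he, hb, hd⟩ := hbd
    by_cases h2 : (support x e).card = 2
    · obtain ⟨w, hw, hbw⟩ := ih
      exact ⟨w, hw, .head ⟨e, Finset.mem_filter.2 ⟨he, h2⟩, hd, hb⟩ hbw⟩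
    · exact ⟨d, ⟨e, he, hd, h2⟩, .refl⟩

end Rounding

/-! ### Counting in the sharing graph and the two claims. -/

namespace ChoreInstance

open Rounding

variable {n m : ℕ} (I : ChoreInstance n m)

lemma isFractional : IsFractional I.x I.c :=
  ⟨I.x_nonneg, I.sum_x, I.c_nonneg, I.c_le_one⟩

lemma mem_holders {i : Fin n} {e : Fin m} : i ∈ I.holders e ↔ 0 < I.x i e := by simp [holders]

lemma support_eq (e : Fin m) : support I.x e = I.holders e := by
  ext i; rw [mem_support, mem_holders]

lemma mem_fractionalItems {e : Fin m} : e ∈ I.fractionalItems ↔ 2 ≤ (I.holders e).card := by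
  simp [fractionalItems]

variable {I}

lemma HasEdge.tail_pos {i k : Fin n} {e : Fin m} (h : HasEdge I.final i e k) : 0 < I.x i e :=
  (I.valid_final.mem_takes i e).1 (h.subset (by simp))

lemma HasEdge.head_pos {i k : Fin n} {e : Fin m} (h : HasEdge I.final i e k) : 0 < I.x k e :=
  (I.valid_final.mem_takes k e).1 (h.subset (by simp))

lemma HasEdge.two_le_card {i k : Fin n} {e : Fin m} (h : HasEdge I.final i e k) :
    2 ≤ (I.holders e).card := by
  rw [← Finset.card_pair (I.forest_final.ne i e k h)]
  refine Finset.card_le_card fun j hj => ?_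
  rw [mem_holders]
  rcases Finset.mem_insert.1 hj with rfl | hj
  · exact h.tail_pos
  · rw [Finset.mem_singleton.1 hj]; exact h.head_pos

variable (I)

open scoped Classical in
/-- The tails of the edges that stand for item `e`. -/
def tails (e : Fin m) : Finset (Fin n) := {i | ∃ k, HasEdge I.final i e k}

lemma mem_tails {i : Fin n} {e : Fin m} : i ∈ I.tails e ↔ ∃ k, HasEdge I.final i e k := by
  simp [tails]

/-- Of two distinct holders of an item one is a tail, so at most one holder is not. -/
lemma card_holders_le (e : Fin m) : (I.holders e).card ≤ (I.tails e).card + 1 := by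
  classical
  have h1 : (I.holders e \ I.tails e).card ≤ 1 := by
    refine Finset.card_le_one.2 fun i hi k hk => ?_
    rw [Finset.mem_sdiff, mem_holders, mem_tails] at hi hk
    by_contra hik
    rcases I.forest_final.tail_or_tail i k e ((I.valid_final.mem_takes i e).2 hi.1)
      ((I.valid_final.mem_takes k e).2 hk.1) hik with h | h
    · exact hi.2 h
    · exact hk.2 h
  have h2 := Finset.card_le_card_sdiff_add_card (s := I.holders e) (t := I.tails e)
  omega

open scoped Classical in
/-- The agents that are not the tail of an edge. -/
def roots : Finset (Fin n) := {i | ∀ e k, ¬ HasEdge I.final i e k}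

lemma mem_roots {i : Fin n} : i ∈ I.roots ↔ ∀ e k, ¬ HasEdge I.final i e k := by
  simp [roots]

/-- No agent is the tail of edges of two items, so the sets of tails and the set of roots are
pairwise disjoint. -/
lemma sum_card_tails_add_card_roots_le (F : Finset (Fin m)) :
    ∑ e ∈ F, (I.tails e).card + I.roots.card ≤ n := by
  classical
  rw [← Finset.card_biUnion, ← Finset.card_union_of_disjoint]
  · simpa using Finset.card_le_univ (F.biUnion I.tails ∪ I.roots)
  · rw [Finset.disjoint_left]
    intro i hi hr
    obtain ⟨e, -, he⟩ := Finset.mem_biUnion.1 hi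
    obtain ⟨k, hk⟩ := I.mem_tails.1 he
    exact I.mem_roots.1 hr e k hk
  · intro e _ f _ hef
    rw [Function.onFun, Finset.disjoint_left]
    intro i hi hi'
    obtain ⟨k, hk⟩ := I.mem_tails.1 hi
    obtain ⟨l, hl⟩ := I.mem_tails.1 hi'
    exact hef (I.forest_final.tail_unique i e f k l hk hl)

lemma cost_eq_of_rounded (F : Finset (Fin m)) (X : Fin m → Fin n) (i : Fin n) (y : Fin m → ℝ)
    (h1 : ∀ e ∈ F, y e = if X e = i then 1 else 0) (h2 : ∀ e ∉ F, y e = I.x i e) :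
    I.cost i y = I.cost i (I.x i) + ∑ e ∈ F, change I.x I.c X i e := by
  have h3 : ∑ e ∈ F, change I.x I.c X i e = ∑ e, (y e - I.x i e) * I.c i e := by
    rw [← Finset.sum_subset (Finset.subset_univ F)]
    · exact Finset.sum_congr rfl fun e he => by rw [change, h1 e he]
    · intro e _ he
      rw [h2 e he, sub_self, zero_mul]
  rw [h3, cost, cost, ← Finset.sum_add_distrib]
  exact Finset.sum_congr rfl fun e _ => by ring

lemma linked_of_adj {T : Set (SharingEdge n m)} (hT : T ⊆ I.edges) {F : Finset (Fin m)}
    (hF : ∀ a ∈ T, a.item ∈ F) {v w : Fin n} (h : (SharingEdge.graph T).Adj v w) :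
    Linked I.x F v w := by
  rw [SharingEdge.graph, SimpleGraph.fromRel_adj] at h
  rcases h.2 with ⟨e, he⟩ | ⟨e, he⟩
  · have h1 : HasEdge I.final v e w := hT he
    exact ⟨e, hF _ he, h1.tail_pos, h1.head_pos⟩
  · have h1 : HasEdge I.final w e v := hT he
    exact ⟨e, hF _ he, h1.head_pos, h1.tail_pos⟩

lemma item_mem_fractionalItems {a : SharingEdge n m} (ha : a ∈ I.edges) :
    a.item ∈ I.fractionalItems := by
  have h1 : HasEdge I.final a.tail a.item a.head := ha
  exact I.mem_fractionalItems.2 h1.two_le_card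

/-- A connected graph on n nodes has at least n-1 edges. If no item had three holders, an item would
determine the edge it labels, giving at least n-1 fractional items. -/
lemma exists_three_le_card_of_connected (hG : (SharingEdge.graph I.edges).Connected)
    (hI : I.fractionalItems.card < n - 1) : ∃ e, 3 ≤ (I.holders e).card := by
  classical
  by_contra! hcon
  have h1 := hG.card_vert_le_card_edgeSet_add_one
  rw [Nat.card_eq_fintype_card, Fintype.card_fin, Nat.card_eq_fintype_card,
    ← SimpleGraph.edgeFinset_card] at h1
  have h2 : ∀ q, ∃ e, q ∈ (SharingEdge.graph I.edges).edgeFinset →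
      e ∈ I.fractionalItems ∧ ∀ v, v ∈ q ↔ v ∈ I.holders e := by
    intro q
    by_cases hq : q ∈ (SharingEdge.graph I.edges).edgeFinset
    · induction q with
      | _ v w =>
      rw [SimpleGraph.mem_edgeFinset, SimpleGraph.mem_edgeSet] at hq
      obtain ⟨e, he, hv, hw⟩ := I.linked_of_adj subset_rfl
        (fun a ha => I.item_mem_fractionalItems ha) hq
      refine ⟨e, fun _ => ⟨he, ?_⟩⟩
      have h3 : ({v, w} : Finset (Fin n)) = I.holders e := by
        refine Finset.eq_of_subset_of_card_le ?_ ?_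
        · intro i hi
          rw [mem_holders]
          rcases Finset.mem_insert.1 hi with rfl | hi
          · exact hv
          · rwa [Finset.mem_singleton.1 hi]
        · rw [Finset.card_pair hq.ne]
          exact Nat.lt_succ_iff.1 (hcon e)
      intro i
      rw [← h3]
      simp
    -- Non-edges need some default item, so `m` must be shown to be positive.
    · have : 0 < n - 1 := by omega
      have hm : 0 < m := by
        by_contra h0
        have : m = 0 := by omega
        subst this
        have h5 : (SharingEdge.graph I.edges).edgeFinset = ∅ := by
          refine Finset.eq_empty_of_forall_notMem fun q hq => ?_
          induction q with
          | _ v w =>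
          rw [SimpleGraph.mem_edgeFinset, SimpleGraph.mem_edgeSet] at hq
          obtain ⟨e, -⟩ := I.linked_of_adj subset_rfl
            (fun a ha => I.item_mem_fractionalItems ha) hq
          exact e.elim0
        rw [h5, Finset.card_empty] at h1
        omega
      exact ⟨⟨0, hm⟩, fun h => absurd h hq⟩
  choose f hf using h2
  have h3 : (SharingEdge.graph I.edges).edgeFinset.card ≤ I.fractionalItems.card := by
    refine Finset.card_le_card_of_injOn f (fun q hq => (hf q hq).1) ?_
    intro q hq r hr hqr
    refine Sym2.ext fun v => ?_
    rw [(hf q hq).2, (hf r hr).2, hqr]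
  omega

/-- The bundle `y` is left general so that it covers both integral allocations and `roundOn`. -/
lemma exists_rounding (F : Finset (Fin m)) (hF : ∀ e ∈ F, 2 ≤ (I.holders e).card) :
    ∃ (B : Finset (Fin n)) (X : Fin m → Fin n) (s : Fin n → ℝ),
      I.IsRounding X ∧
      (∀ i, 0 ≤ s i ∧ ∀ y : Fin m → ℝ, (∀ e ∈ F, y e = if X e = i then 1 else 0) →
        (∀ e ∉ F, y e = I.x i e) → I.cost i y - s i ≤ I.cost i (I.x i)) ∧
      ∑ i, s i ≤ (∑ e ∈ F, ((I.tails e).card : ℝ)) / 3 + B.card / 6 ∧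
      ∀ v ∈ B, (∃ e ∈ F, 0 < I.x v e) ∧
        ∀ w, Relation.ReflTransGen (Linked I.x (twoItems I.x F)) v w →
          (∀ e ∈ F, 0 < I.x w e → (I.holders e).card = 2) ∧ (w ∈ B → w = v) := by
  classical
  obtain ⟨B, ⟨X, hX, hsum⟩, hB⟩ := exists_roundsWithin I.isFractional F
    (fun e he => by rw [support_eq]; exact hF e he)
  simp only [support_eq] at hsum hB
  let Y : Fin m → Fin n := fun e => if e ∈ F then X e else (exists_pos I.isFractional e).choose
  have hYX : ∀ e ∈ F, Y e = X e := fun e he => if_pos he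
  refine ⟨B, Y, fun i => max (∑ e ∈ F, change I.x I.c X i e) 0, fun e => ?_, fun i => ?_, ?_, hB⟩
  · by_cases he : e ∈ F
    · rw [hYX e he]; exact hX e he
    · simp only [Y, he, if_false]
      exact (exists_pos I.isFractional e).choose_spec
  · refine ⟨le_max_right _ _, fun y h1 h2 => ?_⟩
    rw [I.cost_eq_of_rounded F X i y (fun e he => by rw [h1 e he, hYX e he]) h2]
    linarith [le_max_left (∑ e ∈ F, change I.x I.c X i e) 0]
  · refine hsum.trans ?_
    have h1 : ∑ e ∈ F, ((I.holders e).card - 1 : ℝ) ≤ ∑ e ∈ F, ((I.tails e).card : ℝ) := by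
      refine Finset.sum_le_sum fun e _ => ?_
      have : ((I.holders e).card : ℝ) ≤ (I.tails e).card + 1 := by
        exact_mod_cast I.card_holders_le e
      linarith
    linarith

/-- The directed walk from an agent of `B` to a root never leaves her component, whose agents hold
no larger item. Distinct agents of `B` lie in distinct components, so their roots differ. -/
lemma card_le_card_roots (B : Finset (Fin n))
    (hB : ∀ v ∈ B, ∀ w,
      Relation.ReflTransGen (Linked I.x (twoItems I.x I.fractionalItems)) v w →
        (∀ e ∈ I.fractionalItems, 0 < I.x w e → (I.holders e).card = 2) ∧ (w ∈ B → w = v)) :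
    B.card ≤ I.roots.card := by
  classical
  have h1 : ∀ v ∈ B, ∀ r, Relation.ReflTransGen (fun i k => ∃ e, HasEdge I.final i e k) v r →
      Relation.ReflTransGen (Linked I.x (twoItems I.x I.fractionalItems)) v r := by
    intro v hv r h
    induction h with
    | refl => exact .refl
    | tail _ hbd ih =>
      obtain ⟨e, he⟩ := hbd
      have h2 := I.mem_fractionalItems.2 he.two_le_card
      refine ih.tail ⟨e, Finset.mem_filter.2 ⟨h2, ?_⟩, he.tail_pos, he.head_pos⟩
      rw [support_eq]
      exact (hB v hv _ ih).1 e h2 he.tail_pos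
  choose r hr hroot using I.forest_final.exists_root
  refine Finset.card_le_card_of_injOn r (fun v _ => I.mem_roots.2 (hroot v)) ?_
  intro v hv w hw hvw
  have h2 := h1 v hv _ (hr v)
  have h3 := reflTransGen_linked_symm (h1 w hw _ (hr w))
  rw [← hvw] at h3
  exact ((hB v hv w (h2.trans h3)).2 hw).symm

lemma connected_of_card_roots_le_one (h : I.roots.card ≤ 1) :
    (SharingEdge.graph I.edges).Connected := by
  have hr : ∀ v r, Relation.ReflTransGen (fun i k => ∃ e, HasEdge I.final i e k) v r →
      (SharingEdge.graph I.edges).Reachable v r := by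
    intro v r hvr
    induction hvr with
    | refl => rfl
    | @tail b d _ hbd ih =>
      obtain ⟨e, he⟩ := hbd
      refine ih.trans (SimpleGraph.Adj.reachable ?_)
      rw [SharingEdge.graph, SimpleGraph.fromRel_adj]
      exact ⟨I.forest_final.ne b e d he, Or.inl ⟨e, he⟩⟩
  have : Nonempty (Fin n) := ⟨I.valid_final.active_nonempty.choose⟩
  refine ⟨fun v w => ?_⟩
  obtain ⟨r, h1, h2⟩ := I.forest_final.exists_root v
  obtain ⟨q, h3, h4⟩ := I.forest_final.exists_root w
  have : r = q := Finset.card_le_one.1 h r (I.mem_roots.2 h2) q (I.mem_roots.2 h4)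
  subst this
  exact (hr v r h1).trans (hr w r h3).symm

lemma card_roots_pos : 0 < I.roots.card := by
  obtain ⟨r, -, h⟩ := I.forest_final.exists_root I.valid_final.active_nonempty.choose
  exact Finset.card_pos.2 ⟨r, I.mem_roots.2 h⟩

lemma exists_wprops (hI : I.fractionalItems.card < n - 1) :
    ∃ (X : Fin m → Fin n) (s : Fin n → ℝ),
      I.IsRounding X ∧ I.IsWPROPS X s ∧ ∑ i, s i ≤ ((n : ℝ) - 1) / 3 := by
  classical
  obtain ⟨B, X, s, hX, hs, hsum, hB⟩ := I.exists_rounding I.fractionalItems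
    (fun e he => I.mem_fractionalItems.1 he)
  refine ⟨X, s, hX, fun i => ⟨(hs i).1, ?_⟩, hsum.trans ?_⟩
  · have h1 := (hs i).2 (fun e => if X e = i then 1 else 0) (fun e _ => rfl) ?_
    · have h2 : I.cost i (fun e => if X e = i then 1 else 0) = ∑ e with X e = i, I.c i e := by
        simp [cost, Finset.sum_filter]
      rw [← h2]
      exact h1.trans (I.cost_x_le i)
    -- An item that is not fractional belongs wholly to `X e` already.
    · intro e he
      have h2 : (I.holders e).card ≤ 1 := by
        rw [mem_fractionalItems] at he; omega
      have h3 : ∀ k, k ≠ X e → I.x k e = 0 := by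
        intro k hk
        by_contra h0
        exact hk (Finset.card_le_one.1 h2 k
          (I.mem_holders.2 ((I.x_nonneg k e).lt_of_ne (Ne.symm h0))) (X e)
          (I.mem_holders.2 (hX e)))
      have h4 := I.sum_x e
      rw [Finset.sum_eq_single_of_mem (X e) (Finset.mem_univ _) fun k _ hk => h3 k hk] at h4
      by_cases h5 : X e = i
      · rw [if_pos h5, ← h5, h4]
      · rw [if_neg h5, h3 i (Ne.symm h5)]
  · have h1 : (∑ e ∈ I.fractionalItems, ((I.tails e).card : ℝ)) + I.roots.card ≤ n := by
      exact_mod_cast I.sum_card_tails_add_card_roots_le I.fractionalItems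
    have h2 : (B.card : ℝ) ≤ I.roots.card := by
      exact_mod_cast I.card_le_card_roots B fun v hv => (hB v hv).2
    have h3 : (1 : ℝ) ≤ I.roots.card := by exact_mod_cast I.card_roots_pos
    -- With r ≥ 2 roots, (n-r)/3 + r/6 = n/3 - r/6 suffices. A single root requires `B` to be empty.
    rcases Nat.lt_or_ge 1 I.roots.card with h4 | h4
    · have : (2 : ℝ) ≤ I.roots.card := by exact_mod_cast h4
      linarith
    · have hG := I.connected_of_card_roots_le_one h4
      obtain ⟨h, hh⟩ := I.exists_three_le_card_of_connected hG hI
      have hB0 : B = ∅ := by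
        refine Finset.eq_empty_of_forall_notMem fun v hv => ?_
        obtain ⟨u, hu⟩ := Finset.card_pos.1 (by omega : 0 < (I.holders h).card)
        have h5 := (SimpleGraph.reachable_iff_reflTransGen u v).1 (hG.preconnected u v)
        obtain ⟨w, ⟨e, he, hwe, he2⟩, hvw⟩ := exists_linked_big (x := I.x)
          (F := I.fractionalItems) (I.mem_fractionalItems.2 (by omega)) (I.mem_holders.1 hu)
          (by rw [support_eq]; omega)
          (Relation.ReflTransGen.mono (fun _ _ h' => I.linked_of_adj subset_rfl
            (fun a ha => I.item_mem_fractionalItems ha) h') _ _ h5)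
        rw [support_eq] at he2
        exact he2 (((hB v hv).2 w hvw).1 e he hwe)
      rw [hB0, Finset.card_empty]
      push_cast
      linarith

lemma exists_rounding_itemTree (T : Finset (SharingEdge n m)) (hT : I.IsItemTree T)
    (hA : I.ContainsAtomPath T) :
    ∃ (X : Fin m → Fin n) (s : Fin n → ℝ),
      I.IsRounding X ∧
      (∀ i, 0 ≤ s i ∧
        I.cost i (I.roundOn T X i) - s i ≤ I.cost i (I.x i) ∧
        I.cost i (I.roundOn T X i) - s i ≤ I.share i) ∧
      ∑ i, s i ≤ (T.card : ℝ) / 3 := by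
  classical
  set F : Finset (Fin m) := T.image SharingEdge.item with hF
  have hmemF : ∀ e, e ∈ F ↔ ∃ a ∈ T, a.item = e := fun e => by simp [hF]
  obtain ⟨B, X, s, hX, hs, hsum, hB⟩ := I.exists_rounding F (fun e he => by
    obtain ⟨a, ha, rfl⟩ := (hmemF e).1 he
    exact I.mem_fractionalItems.1 (I.item_mem_fractionalItems (hT.subset a ha)))
  -- The first three agents of the atom-path hold a common item, and the tree connects it to every
  -- agent of `B`.
  have hB0 : B = ∅ := by
    refine Finset.eq_empty_of_forall_notMem fun v hv => ?_
    obtain ⟨e, p, ⟨hlen, ⟨hnodup, -⟩, -⟩, hchain⟩ := hA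
    obtain ⟨i, j, k, q, rfl⟩ : ∃ i j k q, p = i :: j :: k :: q := by
      match p, hlen with
      | i :: j :: k :: q, _ => exact ⟨i, j, k, q, rfl⟩
    have hij : (⟨i, e, j⟩ : SharingEdge n m) ∈ T := by
      simp only [List.isChain_cons_cons] at hchain
      exact hchain.1
    have hjk : (⟨j, e, k⟩ : SharingEdge n m) ∈ T := by
      simp only [List.isChain_cons_cons] at hchain
      exact hchain.2.1
    have hij' : HasEdge I.final i e j := hT.subset _ hij
    have hjk' : HasEdge I.final j e k := hT.subset _ hjk
    have hcard : 3 ≤ (I.holders e).card := by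
      have h1 : ({i, j, k} : Finset (Fin n)) ⊆ I.holders e := by
        intro l hl
        simp only [Finset.mem_insert, Finset.mem_singleton] at hl
        rw [mem_holders]
        rcases hl with rfl | rfl | rfl
        · exact hij'.tail_pos
        · exact hjk'.tail_pos
        · exact hjk'.head_pos
      have h2 : ({i, j, k} : Finset (Fin n)).card = 3 := by
        refine Finset.card_eq_three.2 ⟨i, j, k, ?_, ?_, ?_, rfl⟩ <;> rintro rfl <;>
          simp at hnodup
      exact h2 ▸ Finset.card_le_card h1
    obtain ⟨f, hf, hvf⟩ := (hB v hv).1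
    obtain ⟨a, ha, rfl⟩ := (hmemF f).1 hf
    have hpath := (SimpleGraph.reachable_iff_reflTransGen _ _).1
      (hT.isTree.connected.preconnected
        ⟨i, ⟨_, Finset.mem_coe.2 hij, Or.inl rfl⟩⟩ ⟨a.tail, ⟨a, Finset.mem_coe.2 ha, Or.inl rfl⟩⟩)
    have hpath' := Relation.ReflTransGen.lift (p := Linked I.x F) Subtype.val
      (fun _ _ h' => I.linked_of_adj (T := (T : Set (SharingEdge n m)))
        (fun a ha => hT.subset a ha) (fun a ha => (hmemF _).2 ⟨a, ha, rfl⟩) h') _ _ hpath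
    have hae : HasEdge I.final a.tail a.item a.head := hT.subset a ha
    obtain ⟨w, ⟨g, hg, hwg, hg2⟩, hvw⟩ := exists_linked_big (x := I.x) (F := F)
      ((hmemF e).2 ⟨_, hij, rfl⟩) hij'.tail_pos (by rw [support_eq]; omega)
      (Relation.ReflTransGen.tail hpath' ⟨a.item, hf, hae.tail_pos, hvf⟩)
    rw [support_eq] at hg2
    exact hg2 (((hB v hv).2 w hvw).1 g hg hwg)
  -- As `T` is closed under equal labels, every tail of an item of `F` is the tail of an edge of
  -- `T`.
  have hcard : ∑ e ∈ F, (I.tails e).card ≤ T.card := by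
    rw [Finset.card_eq_sum_card_image SharingEdge.item T]
    refine Finset.sum_le_sum fun e he => ?_
    obtain ⟨a, ha, rfl⟩ := (hmemF e).1 he
    refine (Finset.card_le_card ?_).trans
      (Finset.card_image_le (s := {b ∈ T | b.item = a.item}) (f := SharingEdge.tail))
    intro i hi
    obtain ⟨k, hk⟩ := I.mem_tails.1 hi
    exact Finset.mem_image.2 ⟨⟨i, a.item, k⟩,
      Finset.mem_filter.2 ⟨hT.closed a ha _ hk rfl, rfl⟩, rfl⟩
  refine ⟨X, s, hX, fun i => ?_, hsum.trans ?_⟩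
  · have h1 := (hs i).2 (I.roundOn T X i) (fun e he => ?_) (fun e he => ?_)
    · exact ⟨(hs i).1, h1, h1.trans (I.cost_x_le i)⟩
    · rw [roundOn, if_pos ((hmemF e).1 he)]
    · rw [roundOn, if_neg (fun h => he ((hmemF e).2 h))]
  · have h1 : ∑ e ∈ F, ((I.tails e).card : ℝ) ≤ T.card := by exact_mod_cast hcard
    rw [hB0, Finset.card_empty]
    push_cast
    linarith

end ChoreInstance

end

theorem mainTheorem1 {n m : ℕ} (I : ChoreInstance n m) (hI : I.IsIDO) :
    (I.fractionalItems.card < n - 1 →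
      ((SharingEdge.graph I.edges).IsTree → ∃ e, 3 ≤ (I.holders e).card) ∧
      ∃ (X : Fin m → Fin n) (s : Fin n → ℝ),
        I.IsRounding X ∧ I.IsWPROPS X s ∧ ∑ i, s i ≤ ((n : ℝ) - 1) / 3) ∧
    (∀ T : Finset (SharingEdge n m), I.IsItemTree T → 2 ≤ T.card → I.ContainsAtomPath T →
      ∃ (X : Fin m → Fin n) (s : Fin n → ℝ),
        I.IsRounding X ∧
        (∀ i, 0 ≤ s i ∧
          I.cost i (I.roundOn T X i) - s i ≤ I.cost i (I.x i) ∧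
          I.cost i (I.roundOn T X i) - s i ≤ I.share i) ∧
        ∑ i, s i ≤ (T.card : ℝ) / 3) :=
  ⟨fun h => ⟨fun hG => I.exists_three_le_card_of_connected hG.connected h, I.exists_wprops h⟩,
    fun T hT _ hA => I.exists_rounding_itemTree T hT hA⟩
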